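/- Functions are complex-valued, $2\pi$-periodic in each of $d$ variables, $\|f\|_p:=\big((2\pi)^{-d}\int_{[0,2\pi)^d}|f(x)|^p\,dx\big)^{1/p}$, and $L_p(\mathbb T^d)$ is the space of those with $\|f\|_p<\infty$. For $h\in\mathbb R^d$ put $\Delta_hf(x)=f(x+h)-f(x)$, and for $k\in\mathbb N$, $t>0$ let $\omega_k(f,t)_p=\sup_{|h|\le t}\|\Delta_h^kf\|_p$, where $|h|$ is the Euclidean length. For $r>0$ and $1\le\theta\le\infty$ fix an integer $k>r$; the Nikol'skii–Besov class $B^r_{p,\theta}$ is the set of all $f\in L_p(\mathbb T^d)$ with $$\|f\|_p+\Big(\int_0^\infty\big(t^{-r}\omega_k(f,t)_p\big)^\theta\,\frac{dt}{t}\Big)^{1/\theta}\le 1\quad(\theta<\infty),\qquad \|f\|_p+\sup_{t>0}t^{-r}\omega_k(f,t)_p\le 1\quad(\theta=\infty).$$ For $l\in\mathbb N$ let $V_l(x)=\prod_{j=1}^d\Big(l^{-1}\sum_{n=l}^{2l-1}\sum_{\nu=-n}^{n}e^{i\nu x_j}\Big)$ and $V_l(f,x)=(2\pi)^{-d}\int_{[0,2\pi)^d}f(y)V_l(x-y)\,dy$.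 Put $\sigma_0(f)=V_1(f)$ and $\sigma_s(f)=V_{2^s}(f)-V_{2^{s-1}}(f)$ for $s\ge1$. The space $B_{q,1}$ consists of all $f\in L_q(\mathbb T^d)$ with $\|f\|_{B_{q,1}}:=\sum_{s=0}^\infty\|\sigma_s(f)\|_q<\infty$. For $F\subset B_{q,1}$ and $m\in\mathbb N$ let $$e_m(F)_{B_{q,1}}:=\sup_{f\in F}\ \inf_{\Theta_m}\ \inf_{(c_n)}\ \Big\|f-\sum_{n\in\Theta_m}c_ne^{i(n,\cdot)}\Big\|_{B_{q,1}},$$ where $\Theta_m$ runs over the sets of $m$ vectors of $\mathbb Z^d$ and the $c_n$ over the complex numbers. **Theorem.** Let $d\ge1$, $2<p<q<\infty$, $1\le\theta\le\infty$, $r>d/2$, and let $k>r$ be an integer. Then $B^r_{p,\theta}\subset B_{q,1}$, and $$e_m(B^r_{p,\theta})_{B_{q,1}}\asymp m^{-r/d},$$ that is, there are constants $0<C_1<C_2$, independent of $m$, such that $C_1m^{-r/d}\le e_m(B^r_{p,\theta})_{B_{q,1}}\le C_2m^{-r/d}$ for all $m\ge1$. -/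

import Mathlib

open MeasureTheory Set
open scoped Real ENNReal

noncomputable section

namespace NikolskiiBesov

/-- The torus `𝕋^d = (ℝ / 2πℤ)^d`; functions on it are the functions on `ℝ^d` that are
`2π`-periodic in each variable. -/
abbrev Torus (d : ℕ) : Type := Fin d → AddCircle (2 * π)

instance fact_two_pi_pos : Fact (0 < 2 * π) := ⟨Real.two_pi_pos⟩

/-- The normalised Lebesgue measure `(2π)^{-d} dx` on `𝕋^d` (of total mass one), so that
`eLpNorm f p (μ d)` is `((2π)^{-d} ∫ |f|^p)^{1/p}`, or the essential supremum for `p = ∞`. -/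
def μ (d : ℕ) : Measure (Torus d) := Measure.pi fun _ => AddCircle.haarAddCircle

/-- The class modulo `2πℤ^d` of a point of `ℝ^d`. -/
def toTorus {d : ℕ} (h : EuclideanSpace ℝ (Fin d)) : Torus d :=
  fun i => ((h i : ℝ) : AddCircle (2 * π))

/-- The exponential `x ↦ e^{i (k, x)}`, `k ∈ ℤ^d`. -/
def expo {d : ℕ} (k : Fin d → ℤ) (x : Torus d) : ℂ := ∏ j, fourier (k j) (x j)

/-! ### Moduli of smoothness and Nikol'skii-Besov classes -/

/-- The modulus of smoothness `ω_k(f, t)_p = sup_{|h| ≤ t} ‖Δ_h^k f‖_p`, where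
`Δ_h f (x) = f (x + h) - f x` and `|h|` is the Euclidean length of `h ∈ ℝ^d`. -/
def modulus {d : ℕ} (k : ℕ) (p : ℝ≥0∞) (f : Torus d → ℂ) (t : ℝ) : ℝ≥0∞ :=
  ⨆ (h : EuclideanSpace ℝ (Fin d)) (_ : ‖h‖ ≤ t), eLpNorm ((fwdDiff (toTorus h))^[k] f) p (μ d)

/-- The Besov seminorm: `(∫_0^∞ (t^{-r} ω_k(f, t)_p)^θ dt/t)^{1/θ}` for `θ < ∞` and
`sup_{t > 0} t^{-r} ω_k(f, t)_p` for `θ = ∞`. -/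
def besovSeminorm {d : ℕ} (k : ℕ) (r : ℝ) (p θ : ℝ≥0∞) (f : Torus d → ℂ) : ℝ≥0∞ :=
  if θ = ∞ then
    ⨆ (t : ℝ) (_ : 0 < t), ENNReal.ofReal (t ^ (-r)) * modulus k p f t
  else
    (∫⁻ t in Ioi (0 : ℝ), (ENNReal.ofReal (t ^ (-r)) * modulus k p f t) ^ θ.toReal
      * ENNReal.ofReal t⁻¹) ^ (1 / θ.toReal)

/-- The norm of `B^r_{p,θ}`, computed with differences of order `k`. -/
def besovNorm {d : ℕ} (k : ℕ) (r : ℝ) (p θ : ℝ≥0∞) (f : Torus d → ℂ) : ℝ≥0∞ :=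
  eLpNorm f p (μ d) + besovSeminorm k r p θ f

/-- The class `B^r_{p,θ}`: the unit ball of the space of that name. -/
def besovClass (d k : ℕ) (r : ℝ) (p θ : ℝ≥0∞) : Set (Torus d → ℂ) :=
  {f | MemLp f p (μ d) ∧ besovNorm k r p θ f ≤ 1}

/-! ### De la Vallée-Poussin means and the space `B_{q,1}` -/

/-- The Dirichlet kernel `D_k(t) = ∑_{m=-k}^k e^{imt}`. -/
def dirichletKernel (k : ℕ) (t : AddCircle (2 * π)) : ℂ :=
  ∑ m ∈ Finset.Icc (-(k : ℤ)) k, fourier m t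

/-- The de la Vallée-Poussin kernel `V_l(t) = l⁻¹ ∑_{k=l}^{2l-1} D_k(t)`, `l ≥ 1`. -/
def vpKernel (l : ℕ) (t : AddCircle (2 * π)) : ℂ :=
  (l : ℂ)⁻¹ * ∑ k ∈ Finset.Ico l (2 * l), dirichletKernel k t

/-- The convolution `V_l(f, x) = (2π)^{-d} ∫ f(y) ∏_j V_l(x_j - y_j) dy`. -/
def vpMean {d : ℕ} (l : ℕ) (f : Torus d → ℂ) (x : Torus d) : ℂ :=
  ∫ y, f y * ∏ j, vpKernel l (x j - y j) ∂(μ d)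

/-- `σ_0(f) = V_1(f)` and `σ_s(f) = V_{2^s}(f) - V_{2^{s-1}}(f)` for `s ≥ 1`. -/
def sigma {d : ℕ} : ℕ → (Torus d → ℂ) → Torus d → ℂ
  | 0, f => vpMean 1 f
  | s + 1, f => vpMean (2 ^ (s + 1)) f - vpMean (2 ^ s) f

/-- The norm `‖f‖_{B_{q,1}} = ∑_{s ≥ 0} ‖σ_s(f)‖_q`. -/
def bq1Norm {d : ℕ} (q : ℝ≥0∞) (f : Torus d → ℂ) : ℝ≥0∞ :=
  ∑' s : ℕ, eLpNorm (sigma s f) q (μ d)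

/-- The space `B_{q,1}` of the functions `f ∈ L_q(𝕋^d)` such that `∑_s ‖σ_s(f)‖_q` converges. -/
def bq1Space (d : ℕ) (q : ℝ≥0∞) : Set (Torus d → ℂ) :=
  {f | MemLp f q (μ d) ∧ bq1Norm q f < ∞}

/-! ### Best `m`-term trigonometric approximation -/

/-- The trigonometric polynomial `∑_{k ∈ Θ} c_k e^{i (k, x)}`. -/
def trigPoly {d : ℕ} (Θ : Finset (Fin d → ℤ)) (c : (Fin d → ℤ) → ℂ) (x : Torus d) : ℂ :=
  ∑ k ∈ Θ, c k * expo k x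

/-- The best `m`-term trigonometric approximation `e_m(f)` of `f` in the (extended) norm `N`. -/
def bestApprox {d : ℕ} (N : (Torus d → ℂ) → ℝ≥0∞) (m : ℕ) (f : Torus d → ℂ) : ℝ≥0∞ :=
  ⨅ (Θ : Finset (Fin d → ℤ)) (_ : Θ.card = m) (c : (Fin d → ℤ) → ℂ), N (f - trigPoly Θ c)

/-- `e_m(F) = sup_{f ∈ F} e_m(f)` in the (extended) norm `N`. -/
def bestApproxClass {d : ℕ} (N : (Torus d → ℂ) → ℝ≥0∞) (m : ℕ) (F : Set (Torus d → ℂ)) :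
    ℝ≥0∞ :=
  ⨆ f ∈ F, bestApprox N m f

end NikolskiiBesov

end

noncomputable section

namespace NikolskiiBesov

open ComplexConjugate

variable {d : ℕ}

/-! Since `p ≥ 2`, a bound for differences in `L_p` is also one in `L_2`, and Parseval turns it into
`(∑ |f̂(n)|²)^{1/2} ≲ 2^{-sr}` over the frequencies with `2^{s-1} ≤ |n|_∞ < 2^s`
(`sum_sq_fc_block_le`). There are at most about `2^{sd}` of them, so Cauchy–Schwarz gives `∑ |f̂(n)|
≲ 2^{-sκ}` with `κ = r - d/2 > 0` (`exists_sum_norm_fc_block_le`). The Fourier series converges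
absolutely, whence the embedding.

Upper bound: a polynomial with absolute coefficient sum `A` is `A` times a convex combination of
unimodular multiples of exponentials. Sampling `M` of these independently gives an `L_q` error `≲ A
M^{-1/2}` for `q < ∞` (`exists_sparse_approx`). Keep every frequency of level at most `N` and spend
about `2^{Nd - κ(i+1)}` terms on level `N + 1 + i`. The budgets add up to `O(2^{Nd})`; the errors
are `≲ 2^{-Nr - κ(i+1)/2}` and add up to `O(2^{-Nr})`, which is `m^{-r/d}` for `m ≍ 2^{Nd}`
(`exists_sparse_approx_besov`). As `σ_s` sees only two levels, errors on blocks control the norm of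
`B_{q,1}`, provided that one sample serves two multipliers at once.

Lower bound: a product of Rudin–Shapiro polynomials has unimodular coefficients on `[0, 2^S)^d` and
sup norm `≲ 2^{Sd/2}`. The bound persists in a complex strip, so Cauchy's estimate controls its
differences, and a multiple of size `2^{-Sr} 2^{-Sd/2}` lies in the class
(`exists_flat_mem_besovClass`). If `2m ≤ 2^{Sd}`, then `m` exponentials miss half of the cube. The
mean `V_{2^S}` preserves the missed coefficients and is bounded from `B_{q,1}` to `L_2`, so Parseval
forces an error `≳ 2^{-Sr}` (`le_bestApprox_flat`). -/

instance : IsProbabilityMeasure (μ d) :=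
  inferInstanceAs (IsProbabilityMeasure (Measure.pi fun _ => AddCircle.haarAddCircle))

instance : (μ d).IsAddLeftInvariant :=
  inferInstanceAs ((Measure.pi fun _ : Fin d =>
    (AddCircle.haarAddCircle : Measure (AddCircle (2 * π)))).IsAddLeftInvariant)

instance : (μ d).IsAddRightInvariant :=
  inferInstance

/-! ### Exponentials on the torus, Fourier coefficients and Parseval's identity -/

@[fun_prop]
lemma continuous_expo (n : Fin d → ℤ) : Continuous (expo n) := by
  unfold expo; fun_prop

lemma expo_zero (x : Torus d) : expo (0 : Fin d → ℤ) x = 1 := by simp [expo]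

lemma expo_neg (n : Fin d → ℤ) (x : Torus d) : expo (-n) x = conj (expo n x) := by
  simp only [expo, Pi.neg_apply, fourier_neg, map_prod]

lemma expo_add (m n : Fin d → ℤ) (x : Torus d) : expo (m + n) x = expo m x * expo n x := by
  simp only [expo, Pi.add_apply, fourier_add, ← Finset.prod_mul_distrib]

lemma fourier_add_apply (n : ℤ) (x y : AddCircle (2 * π)) :
    fourier n (x + y) = fourier n x * (fourier n y : ℂ) := by
  simp [fourier_apply, smul_add, AddCircle.toCircle_add]

lemma expo_apply_add (n : Fin d → ℤ) (x y : Torus d) : expo n (x + y) = expo n x * expo n y := by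
  simp only [expo, Pi.add_apply, fourier_add_apply, ← Finset.prod_mul_distrib]

@[simp]
lemma norm_expo (n : Fin d → ℤ) (x : Torus d) : ‖expo n x‖ = 1 := by
  rw [expo, norm_prod]
  exact Finset.prod_eq_one fun j _ => Circle.norm_coe _

lemma expo_apply_neg (n : Fin d → ℤ) (x : Torus d) : expo n (-x) = expo (-n) x := by
  simp [expo, fourier_apply]

lemma integral_fourier (n : ℤ) :
    ∫ x, (fourier n x : ℂ) ∂(AddCircle.haarAddCircle (T := 2 * π)) = if n = 0 then 1 else 0 := by
  have h := (orthonormal_iff_ite.mp (orthonormal_fourier (T := 2 * π))) 0 n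
  rw [ContinuousMap.inner_toLp] at h
  simpa [eq_comm] using h

lemma integral_expo (n : Fin d → ℤ) : ∫ x, expo n x ∂(μ d) = if n = 0 then 1 else 0 := by
  unfold expo μ
  rw [integral_fintype_prod_eq_prod (fun j x => (fourier (n j) x : ℂ))]
  simp only [integral_fourier]
  split_ifs with h
  · simp [h]
  · obtain ⟨i, hi⟩ := Function.ne_iff.mp h
    exact Finset.prod_eq_zero (Finset.mem_univ i) (if_neg hi)

/-- The exponential as a continuous map. -/
def expoC (n : Fin d → ℤ) : C(Torus d, ℂ) := ⟨expo n, continuous_expo n⟩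

lemma expoC_apply (n : Fin d → ℤ) (x : Torus d) : expoC n x = expo n x := rfl

/-- The star subalgebra of continuous functions generated by the exponentials. -/
def expoSubalgebra (d : ℕ) : StarSubalgebra ℂ C(Torus d, ℂ) where
  toSubalgebra := Algebra.adjoin ℂ (range expoC)
  star_mem' := by
    change Algebra.adjoin ℂ (range expoC) ≤ star (Algebra.adjoin ℂ (range expoC))
    refine Algebra.adjoin_le ?_
    rintro _ ⟨n, rfl⟩
    refine Algebra.subset_adjoin ⟨-n, ?_⟩
    ext1 x
    simp only [expoC_apply, expo_neg, starRingEnd_apply, ContinuousMap.star_apply]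

lemma expoSubalgebra_coe :
    (expoSubalgebra d).toSubalgebra.toSubmodule = Submodule.span ℂ (range expoC) := by
  apply Algebra.adjoin_eq_span_of_subset
  refine .trans (fun x ↦ Submonoid.closure_induction (fun _ ↦ id) ⟨0, ?_⟩ ?_)
    Submodule.subset_span
  · ext z
    simp [expoC_apply, expo_zero]
  · rintro _ _ _ _ ⟨m, rfl⟩ ⟨n, rfl⟩
    refine ⟨m + n, ?_⟩
    ext z
    simp [expoC_apply, expo_add]

lemma expo_single (z : Torus d) (i : Fin d) : expo (Pi.single i 1) z = fourier 1 (z i) := by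
  rw [expo, Finset.prod_eq_single i]
  · simp
  · intro j _ hj
    simp [Pi.single_eq_of_ne hj]
  · simp

lemma expoSubalgebra_separatesPoints : (expoSubalgebra d).SeparatesPoints := by
  intro x y hxy
  rw [Ne, funext_iff, not_forall] at hxy
  obtain ⟨i, hi⟩ := hxy
  refine ⟨_, ⟨expoC (Pi.single i 1), Algebra.subset_adjoin ⟨Pi.single i 1, rfl⟩, rfl⟩, ?_⟩
  change expo _ x ≠ expo _ y
  rw [expo_single, expo_single, fourier_one, fourier_one, Ne]
  contrapose hi
  exact AddCircle.injective_toCircle Real.two_pi_pos.ne' (Circle.ext hi)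

/-- Stone–Weierstrass; uniform density then passes to `L²` and makes the exponentials a Hilbert
basis. -/
lemma span_expoC_closure_eq_top :
    (Submodule.span ℂ (range (expoC (d := d)))).topologicalClosure = ⊤ := by
  rw [← expoSubalgebra_coe]
  exact congr_arg (Subalgebra.toSubmodule <| StarSubalgebra.toSubalgebra ·)
    (ContinuousMap.starSubalgebra_topologicalClosure_eq_top_of_separatesPoints _
      expoSubalgebra_separatesPoints)

/-- The exponential as an element of `L²`. -/
abbrev expoLp (n : Fin d → ℤ) : Lp ℂ 2 (μ d) := ContinuousMap.toLp (E := ℂ) 2 (μ d) ℂ (expoC n)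

lemma span_expoLp_closure_eq_top :
    (Submodule.span ℂ (range (expoLp (d := d)))).topologicalClosure = ⊤ := by
  simpa only [Submodule.map_span, ContinuousLinearMap.coe_coe, ← range_comp,
    Function.comp_def] using
    (ContinuousMap.toLp_denseRange ℂ (μ d) ℂ
      (ENNReal.ofNat_ne_top : (2 : ℝ≥0∞) ≠ ∞)).topologicalClosure_map_submodule
      span_expoC_closure_eq_top

lemma orthonormal_expoLp : Orthonormal ℂ (expoLp (d := d)) := by
  rw [orthonormal_iff_ite]
  intro m n
  rw [ContinuousMap.inner_toLp]
  simp only [expoC_apply, ← expo_neg, ← expo_add, integral_expo]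
  refine if_congr ?_ rfl rfl
  rw [add_neg_eq_zero, eq_comm]

/-- The exponentials as a Hilbert basis of `L²`. -/
def expoBasis (d : ℕ) : HilbertBasis (Fin d → ℤ) ℂ (Lp ℂ 2 (μ d)) :=
  HilbertBasis.mk orthonormal_expoLp span_expoLp_closure_eq_top.ge

/-- The Fourier coefficient `(2π)^{-d} ∫ f(x) e^{-i(n, x)} dx`. -/
def fc (f : Torus d → ℂ) (n : Fin d → ℤ) : ℂ := ∫ x, expo (-n) x * f x ∂(μ d)

lemma integrable_expo_mul {f : Torus d → ℂ} (hf : Integrable f (μ d)) (n : Fin d → ℤ) :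
    Integrable (fun x => expo n x * f x) (μ d) :=
  hf.bdd_mul (c := 1) (continuous_expo n).aestronglyMeasurable (by simp)

lemma fc_congr_ae {f g : Torus d → ℂ} (h : f =ᵐ[μ d] g) : fc f = fc g := by
  ext n
  exact integral_congr_ae (by filter_upwards [h] with x hx; rw [hx])

lemma fc_sub {f g : Torus d → ℂ} (hf : Integrable f (μ d)) (hg : Integrable g (μ d))
    (n : Fin d → ℤ) : fc (f - g) n = fc f n - fc g n := by
  simp only [fc, Pi.sub_apply, mul_sub]
  exact integral_sub (integrable_expo_mul hf _) (integrable_expo_mul hg _)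

@[fun_prop]
lemma continuous_trigPoly (Θ : Finset (Fin d → ℤ)) (c : (Fin d → ℤ) → ℂ) :
    Continuous (trigPoly Θ c) := by
  unfold trigPoly; fun_prop

lemma integrable_of_continuous {f : Torus d → ℂ} (hf : Continuous f) : Integrable f (μ d) :=
  hf.integrable_of_hasCompactSupport (HasCompactSupport.of_compactSpace f)

lemma fc_trigPoly (Θ : Finset (Fin d → ℤ)) (c : (Fin d → ℤ) → ℂ) (n : Fin d → ℤ) :
    fc (trigPoly Θ c) n = if n ∈ Θ then c n else 0 := by
  have h : ∀ x : Torus d, expo (-n) x * trigPoly Θ c x = ∑ k ∈ Θ, c k * expo (-n + k) x := by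
    intro x
    rw [trigPoly, Finset.mul_sum]
    refine Finset.sum_congr rfl fun k _ => ?_
    rw [expo_add]; ring
  simp only [fc, h]
  rw [integral_finsetSum _ fun k _ => integrable_of_continuous (by fun_prop)]
  simp only [integral_const_mul, integral_expo, neg_add_eq_zero, mul_ite, mul_one, mul_zero,
    Finset.sum_ite_eq]

lemma expoBasis_repr (f : Lp ℂ 2 (μ d)) (n : Fin d → ℤ) : (expoBasis d).repr f n = fc f n := by
  rw [(expoBasis d).repr_apply_apply f n, L2.inner_def, expoBasis, HilbertBasis.coe_mk, fc]
  apply integral_congr_ae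
  filter_upwards [ContinuousMap.coeFn_toLp (μ d) (𝕜 := ℂ) (p := 2) (expoC n)] with x hx
  rw [hx, RCLike.inner_apply, expoC_apply, expo_neg, mul_comm]

lemma hasSum_sq_fc {f : Torus d → ℂ} (hf : MemLp f 2 (μ d)) :
    HasSum (fun n => ‖fc f n‖ ^ 2) ((eLpNorm f 2 (μ d)).toReal ^ 2) := by
  have h := (expoBasis d).hasSum_inner_mul_inner hf.toLp hf.toLp
  have h2 := RCLike.hasSum_re ℂ h
  rw [inner_self_eq_norm_sq, Lp.norm_toLp] at h2
  refine h2.congr_fun fun n => ?_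
  rw [← inner_conj_symm, ← HilbertBasis.repr_apply_apply, expoBasis_repr,
    fc_congr_ae hf.coeFn_toLp, RCLike.conj_mul]
  norm_cast

lemma sum_sq_fc_le {f : Torus d → ℂ} (hf : MemLp f 2 (μ d)) (K : Finset (Fin d → ℤ)) :
    ∑ n ∈ K, ‖fc f n‖ ^ 2 ≤ (eLpNorm f 2 (μ d)).toReal ^ 2 :=
  sum_le_hasSum K (fun _ _ => by positivity) (hasSum_sq_fc hf)

lemma ae_eq_zero_of_fc_eq_zero {f : Torus d → ℂ} (hf : MemLp f 2 (μ d)) (h : ∀ n, fc f n = 0) :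
    f =ᵐ[μ d] 0 := by
  have h1 := hasSum_sq_fc hf
  simp only [h, norm_zero, ne_eq, OfNat.ofNat_ne_zero, not_false_eq_true, zero_pow] at h1
  have h2 := h1.unique hasSum_zero
  rw [sq_eq_zero_iff, ENNReal.toReal_eq_zero_iff, or_iff_left hf.2.ne,
    eLpNorm_eq_zero_iff hf.1 (by norm_num)] at h2
  exact h2

/-- A square integrable function with absolutely summable Fourier coefficients is almost
everywhere equal to a continuous function. -/
lemma memLp_of_summable_fc {f : Torus d → ℂ} (hf : MemLp f 2 (μ d))
    (h : Summable fun n => ‖fc f n‖) (q : ℝ≥0∞) : MemLp f q (μ d) := by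
  set F : Torus d → ℂ := fun x => ∑' n, fc f n * expo n x with hF
  have hFc : Continuous F := continuous_tsum (fun n => by fun_prop) h (by simp)
  have hFm : ∀ q, MemLp F q (μ d) := fun q =>
    (BoundedContinuousFunction.mkOfCompact ⟨F, hFc⟩).memLp_top.mono_exponent le_top
  -- Absolute convergence permits termwise integration; Parseval then identifies `f` with its
  -- Fourier series `F` almost everywhere.
  have hcoef : ∀ n, fc F n = fc f n := by
    intro n
    have h1 : ∀ x, expo (-n) x * F x = ∑' k, fc f k * expo (-n + k) x := by
      intro x
      rw [hF, ← tsum_mul_left]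
      refine tsum_congr fun k => ?_
      rw [expo_add]; ring
    rw [fc]
    simp only [h1]
    rw [← integral_tsum_of_summable_integral_norm
      (fun k => integrable_of_continuous (by fun_prop)) (by simpa using h)]
    simp only [integral_const_mul, integral_expo, neg_add_eq_zero, mul_ite, mul_one, mul_zero]
    rw [tsum_eq_single n (by intro m hm; simp [hm.symm])]
    simp
  have h0 := ae_eq_zero_of_fc_eq_zero (hf.sub (hFm 2)) fun n => by
    rw [fc_sub (hf.integrable (by norm_num)) ((hFm 2).integrable (by norm_num)), hcoef, sub_self]
  have h1 : f =ᵐ[μ d] F := by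
    filter_upwards [h0] with x hx
    simpa [sub_eq_zero] using hx
  exact (memLp_congr_ae h1).mpr (hFm q)

/-! ### Translations and differences as Fourier multipliers -/

lemma fc_comp_add {f : Torus d → ℂ} (h : Torus d) (n : Fin d → ℤ) :
    fc (fun x => f (x + h)) n = expo n h * fc f n := by
  unfold fc
  rw [← integral_add_right_eq_self (μ := μ d) (fun x => expo (-n) x * f x) h,
    ← integral_const_mul]
  refine integral_congr_ae (.of_forall fun x => ?_)
  have h1 : expo n h * expo (-n) h = 1 := by rw [← expo_add]; simp [expo_zero]
  simp only [expo_apply_add]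
  linear_combination (-expo (-n) x * f (x + h)) * h1

lemma memLp_comp_add {f : Torus d → ℂ} {p : ℝ≥0∞} (hf : MemLp f p (μ d)) (h : Torus d) :
    MemLp (fun x => f (x + h)) p (μ d) :=
  hf.comp_measurePreserving (measurePreserving_add_right (μ d) h)

lemma memLp_fwdDiff_iter {f : Torus d → ℂ} {p : ℝ≥0∞} (hf : MemLp f p (μ d)) (h : Torus d)
    (k : ℕ) : MemLp ((fwdDiff h)^[k] f) p (μ d) := by
  induction k with
  | zero => exact hf
  | succ k ih =>
    rw [Function.iterate_succ_apply']
    exact (memLp_comp_add ih h).sub ih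

lemma fc_fwdDiff_iter {f : Torus d → ℂ} (hf : MemLp f 1 (μ d)) (h : Torus d)
    (k : ℕ) (n : Fin d → ℤ) :
    fc ((fwdDiff h)^[k] f) n = (expo n h - 1) ^ k * fc f n := by
  induction k with
  | zero => simp
  | succ k ih =>
    have hk := memLp_fwdDiff_iter hf h k
    rw [Function.iterate_succ_apply']
    have : fwdDiff h ((fwdDiff h)^[k] f) =
      (fun x => (fwdDiff h)^[k] f (x + h)) - (fwdDiff h)^[k] f := rfl
    rw [this, fc_sub (memLp_one_iff_integrable.1 (memLp_comp_add hk h))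
      (memLp_one_iff_integrable.1 hk), fc_comp_add, ih]
    ring

/-! ### Dyadic blocks of frequencies -/

/-- The largest modulus of the coordinates of a frequency. -/
def supAbs (n : Fin d → ℤ) : ℕ := Finset.univ.sup fun j => (n j).natAbs

/-- The dyadic level of a frequency: `0` for the zero frequency and `s` when
`2^(s-1) ≤ |n|_∞ < 2^s`. -/
def level (n : Fin d → ℤ) : ℕ := (supAbs n).size

/-- The frequencies in the cube `[-N, N]^d`. -/
def box (d N : ℕ) : Finset (Fin d → ℤ) := Fintype.piFinset fun _ => Finset.Icc (-(N : ℤ)) N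

/-- The frequencies of level `s`. -/
def block (d s : ℕ) : Finset (Fin d → ℤ) := (box d (2 ^ s)).filter fun n => level n = s

lemma natAbs_le_supAbs (n : Fin d → ℤ) (j : Fin d) : (n j).natAbs ≤ supAbs n :=
  Finset.le_sup (f := fun j => (n j).natAbs) (Finset.mem_univ j)

lemma supAbs_le_iff {n : Fin d → ℤ} {N : ℕ} : supAbs n ≤ N ↔ ∀ j, (n j).natAbs ≤ N := by
  simp [supAbs]

lemma mem_box {n : Fin d → ℤ} {N : ℕ} : n ∈ box d N ↔ supAbs n ≤ N := by
  simp only [box, Fintype.mem_piFinset, Finset.mem_Icc, supAbs_le_iff]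
  exact forall_congr' fun j => by omega

lemma exists_natAbs_eq_supAbs {n : Fin d → ℤ} (h : 0 < supAbs n) :
    ∃ j, (n j).natAbs = supAbs n := by
  by_contra! hne
  have : supAbs n ≤ supAbs n - 1 := supAbs_le_iff.2 fun j => by
    have h1 := natAbs_le_supAbs n j
    have h2 := hne j
    omega
  omega

lemma level_le_iff {n : Fin d → ℤ} {s : ℕ} : level n ≤ s ↔ supAbs n < 2 ^ s := Nat.size_le

lemma lt_level_iff {n : Fin d → ℤ} {s : ℕ} : s < level n ↔ 2 ^ s ≤ supAbs n := Nat.lt_size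

/-- The cube in the definition of `block` merely supplies finiteness: level `s` already forces
`|n|_∞ < 2^s`. -/
lemma mem_block {n : Fin d → ℤ} {s : ℕ} : n ∈ block d s ↔ level n = s := by
  rw [block, Finset.mem_filter, and_iff_right_iff_imp, mem_box]
  intro h
  exact (level_le_iff.1 h.le).le

lemma card_box (d N : ℕ) : (box d N).card = (2 * N + 1) ^ d := by
  simp only [box, Fintype.card_piFinset, Int.card_Icc, Finset.prod_const, Finset.card_univ,
    Fintype.card_fin]
  congr 1
  omega

lemma card_block_le (d s : ℕ) : (block d s).card ≤ 3 ^ d * 2 ^ (s * d) := by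
  refine (Finset.card_filter_le _ _).trans ?_
  rw [card_box, pow_mul, ← mul_pow]
  gcongr
  have := Nat.one_le_two_pow (n := s)
  omega

lemma disjoint_block {s t : ℕ} (h : s ≠ t) : Disjoint (block d s) (block d t) := by
  rw [Finset.disjoint_left]
  intro n hs ht
  rw [mem_block] at hs ht
  omega

/-! ### Multipliers of the de la Vallée-Poussin means -/

/-- The Fourier coefficients of the one-dimensional de la Vallée-Poussin kernel. -/
def vpw (l : ℕ) (ν : ℤ) : ℝ := (l : ℝ)⁻¹ * ∑ k ∈ Finset.Ico l (2 * l), if ν.natAbs ≤ k then 1 else 0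

/-- The Fourier coefficients of the `d`-dimensional de la Vallée-Poussin kernel. -/
def vpm (l : ℕ) (n : Fin d → ℤ) : ℝ := ∏ j, vpw l (n j)

lemma vpw_nonneg (l : ℕ) (ν : ℤ) : 0 ≤ vpw l ν := by unfold vpw; positivity

lemma vpw_le_one (l : ℕ) (ν : ℤ) : vpw l ν ≤ 1 := by
  unfold vpw
  have h : (∑ k ∈ Finset.Ico l (2 * l), if ν.natAbs ≤ k then (1 : ℝ) else 0) ≤ l := by
    calc _ ≤ ∑ k ∈ Finset.Ico l (2 * l), (1 : ℝ) := by
          refine Finset.sum_le_sum fun k _ => ?_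
          split_ifs <;> norm_num
      _ = l := by
          simp [two_mul]
  exact inv_mul_le_one_of_le₀ h (by positivity)

lemma vpw_eq_one {l : ℕ} (hl : 0 < l) {ν : ℤ} (h : ν.natAbs ≤ l) : vpw l ν = 1 := by
  unfold vpw
  rw [Finset.sum_congr rfl (g := fun _ => (1 : ℝ))]
  · have : (l : ℝ) ≠ 0 := by positivity
    simp [two_mul, this]
  · intro k hk
    rw [Finset.mem_Ico] at hk
    rw [if_pos (by omega)]

lemma vpw_eq_zero {l : ℕ} {ν : ℤ} (h : 2 * l ≤ ν.natAbs) : vpw l ν = 0 := by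
  unfold vpw
  rw [Finset.sum_eq_zero, mul_zero]
  intro k hk
  rw [Finset.mem_Ico] at hk
  rw [if_neg (by omega)]

lemma vpm_nonneg (l : ℕ) (n : Fin d → ℤ) : 0 ≤ vpm l n :=
  Finset.prod_nonneg fun _ _ => vpw_nonneg _ _

lemma vpm_le_one (l : ℕ) (n : Fin d → ℤ) : vpm l n ≤ 1 :=
  Finset.prod_le_one (fun _ _ => vpw_nonneg _ _) fun _ _ => vpw_le_one _ _

lemma vpm_eq_one {l : ℕ} (hl : 0 < l) {n : Fin d → ℤ} (h : supAbs n ≤ l) : vpm l n = 1 :=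
  Finset.prod_eq_one fun j _ => vpw_eq_one hl ((natAbs_le_supAbs n j).trans h)

lemma vpm_eq_zero {l : ℕ} (hl : 0 < l) {n : Fin d → ℤ} (h : 2 * l ≤ supAbs n) : vpm l n = 0 := by
  obtain ⟨j, hj⟩ := exists_natAbs_eq_supAbs (n := n) (by omega)
  exact Finset.prod_eq_zero (Finset.mem_univ j) (vpw_eq_zero (by omega))

lemma vpKernel_eq (l : ℕ) (t : AddCircle (2 * π)) :
    vpKernel l t = ∑ ν ∈ Finset.Icc (-((2 * l : ℕ) : ℤ)) ((2 * l : ℕ) : ℤ),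
      (vpw l ν : ℂ) * fourier ν t := by
  have h : ∀ k ∈ Finset.Ico l (2 * l), dirichletKernel k t =
      ∑ ν ∈ Finset.Icc (-((2 * l : ℕ) : ℤ)) ((2 * l : ℕ) : ℤ),
        if ν.natAbs ≤ k then (fourier ν t : ℂ) else 0 := by
    intro k hk
    rw [Finset.mem_Ico] at hk
    rw [dirichletKernel, ← Finset.sum_filter]
    refine Finset.sum_congr ?_ fun _ _ => rfl
    ext ν
    simp only [Finset.mem_filter, Finset.mem_Icc]
    omega
  rw [vpKernel, Finset.sum_congr rfl h, Finset.sum_comm, Finset.mul_sum]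
  refine Finset.sum_congr rfl fun ν _ => ?_
  rw [vpw]
  push_cast
  rw [mul_assoc, Finset.sum_mul]
  congr 1
  refine Finset.sum_congr rfl fun k _ => ?_
  split_ifs <;> simp

lemma prod_vpKernel_eq (l : ℕ) (x : Torus d) :
    ∏ j, vpKernel l (x j) = ∑ n ∈ box d (2 * l), (vpm l n : ℂ) * expo n x := by
  simp only [vpKernel_eq]
  rw [Finset.prod_univ_sum]
  refine Finset.sum_congr rfl fun n _ => ?_
  simp [vpm, expo, Finset.prod_mul_distrib]

lemma trigPoly_eq_of_support {A B : Finset (Fin d → ℤ)} {c : (Fin d → ℤ) → ℂ}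
    (hA : ∀ n, c n ≠ 0 → n ∈ A) (hB : ∀ n, c n ≠ 0 → n ∈ B) : trigPoly A c = trigPoly B c := by
  classical
  ext x
  unfold trigPoly
  rw [Finset.sum_subset (Finset.subset_union_left (s₁ := A) (s₂ := B)),
    Finset.sum_subset (Finset.subset_union_right (s₁ := A) (s₂ := B))]
  · intro n _ hn
    rw [not_imp_comm.1 (hB n) hn, zero_mul]
  · intro n _ hn
    rw [not_imp_comm.1 (hA n) hn, zero_mul]

lemma vpMean_eq_trigPoly_box (l : ℕ) {f : Torus d → ℂ} (hf : Integrable f (μ d)) :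
    vpMean l f = trigPoly (box d (2 * l)) fun n => vpm l n * fc f n := by
  ext x
  have h : ∀ y, f y * ∏ j, vpKernel l (x j - y j) =
      ∑ n ∈ box d (2 * l), (vpm l n * expo n x) * (expo (-n) y * f y) := by
    intro y
    have := prod_vpKernel_eq l (x - y)
    simp only [Pi.sub_apply] at this
    rw [this, Finset.mul_sum]
    refine Finset.sum_congr rfl fun n _ => ?_
    rw [sub_eq_add_neg, expo_apply_add, expo_apply_neg]
    ring
  simp only [vpMean, h]
  rw [integral_finsetSum _ fun n _ => (integrable_expo_mul hf _).const_mul _]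
  refine Finset.sum_congr rfl fun n _ => ?_
  rw [integral_const_mul]
  change _ = vpm l n * fc f n * expo n x
  rw [fc]
  ring

lemma vpMean_eq_trigPoly {l : ℕ} (hl : 0 < l) {f : Torus d → ℂ} (hf : Integrable f (μ d))
    {B : Finset (Fin d → ℤ)} (hB : ∀ n, supAbs n < 2 * l → n ∈ B) :
    vpMean l f = trigPoly B fun n => vpm l n * fc f n := by
  rw [vpMean_eq_trigPoly_box l hf]
  have h : ∀ n : Fin d → ℤ, (vpm l n : ℂ) * fc f n ≠ 0 → supAbs n < 2 * l := by
    intro n hn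
    by_contra! h0
    rw [vpm_eq_zero hl h0] at hn
    simp at hn
  exact trigPoly_eq_of_support (fun n hn => mem_box.2 (h n hn).le) fun n hn => hB n (h n hn)

/-- The multiplier of the operator `σ_s`. -/
def sigmaMult : ℕ → (Fin d → ℤ) → ℝ
  | 0, n => vpm 1 n
  | s + 1, n => vpm (2 ^ (s + 1)) n - vpm (2 ^ s) n

lemma abs_sigmaMult_le (s : ℕ) (n : Fin d → ℤ) : |sigmaMult s n| ≤ 1 := by
  cases s with
  | zero => rw [sigmaMult, abs_of_nonneg (vpm_nonneg _ _)]; exact vpm_le_one _ _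
  | succ s =>
    rw [sigmaMult, abs_le]
    constructor <;> linarith [vpm_nonneg (2 ^ (s + 1)) n, vpm_le_one (2 ^ (s + 1)) n,
      vpm_nonneg (2 ^ s) n, vpm_le_one (2 ^ s) n]

/-- The multipliers of both means are `1` up to `2^{s-1}` and `0` from `2^{s+1}` on, so their
difference `σ_s` lives on levels `s` and `s + 1`. For `s = 0` only the upper cut-off is needed. -/
lemma sigmaMult_eq_zero {s : ℕ} {n : Fin d → ℤ} (h : level n ≠ s) (h' : level n ≠ s + 1) :
    sigmaMult s n = 0 := by
  cases s with
  | zero =>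
    have : 1 < level n := by omega
    rw [lt_level_iff] at this
    exact vpm_eq_zero one_pos (by simpa using this)
  | succ s =>
    rw [sigmaMult]
    rcases lt_or_gt_of_ne h with h1 | h1
    · have h2 : supAbs n < 2 ^ s := level_le_iff.1 (by omega)
      rw [vpm_eq_one (by positivity) h2.le, vpm_eq_one (by positivity), sub_self]
      rw [pow_succ]; omega
    · have h2 : 2 ^ (s + 2) ≤ supAbs n := lt_level_iff.1 (by omega)
      rw [vpm_eq_zero (by positivity), vpm_eq_zero (by positivity), sub_self] <;>
        · ring_nf at h2 ⊢; omega

lemma sigma_eq_trigPoly (s : ℕ) {f : Torus d → ℂ} (hf : Integrable f (μ d))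
    {B : Finset (Fin d → ℤ)} (hB : ∀ n, supAbs n < 2 ^ (s + 1) → n ∈ B) :
    sigma s f = trigPoly B fun n => sigmaMult s n * fc f n := by
  cases s with
  | zero => exact vpMean_eq_trigPoly one_pos hf (by simpa using hB)
  | succ s =>
    rw [sigma, vpMean_eq_trigPoly (by positivity) hf (B := B),
      vpMean_eq_trigPoly (by positivity) hf (B := B)]
    · ext x
      simp only [trigPoly, Pi.sub_apply, ← Finset.sum_sub_distrib]
      refine Finset.sum_congr rfl fun n _ => ?_
      rw [sigmaMult]; push_cast; ring
    · intro n hn; refine hB n (hn.trans_le ?_); rw [pow_succ, pow_succ]; omega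
    · intro n hn; refine hB n (hn.trans_le ?_); rw [pow_succ 2 (s + 1)]; omega

lemma sigma_eq_block (s : ℕ) {f : Torus d → ℂ} (hf : Integrable f (μ d)) :
    sigma s f = trigPoly (block d s) (fun n => sigmaMult s n * fc f n) +
      trigPoly (block d (s + 1)) (fun n => sigmaMult s n * fc f n) := by
  classical
  have h : sigma s f = trigPoly (block d s ∪ block d (s + 1))
      fun n => sigmaMult s n * fc f n := by
    rw [sigma_eq_trigPoly s hf (B := box d (2 ^ (s + 1))) fun n hn => mem_box.2 hn.le]
    have h0 : ∀ n : Fin d → ℤ, (sigmaMult s n : ℂ) * fc f n ≠ 0 →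
        level n = s ∨ level n = s + 1 := by
      intro n hn
      by_contra! h0
      rw [sigmaMult_eq_zero h0.1 h0.2] at hn
      simp at hn
    refine trigPoly_eq_of_support (fun n hn => ?_) fun n hn => ?_
    · have : level n ≤ s + 1 := by have := h0 n hn; omega
      exact mem_box.2 (level_le_iff.1 this).le
    · simpa [mem_block] using h0 n hn
  rw [h]
  ext x
  exact Finset.sum_union (disjoint_block (by omega))

lemma sum_sigma (S : ℕ) (f : Torus d → ℂ) :
    ∑ s ∈ Finset.range (S + 1), sigma s f = vpMean (2 ^ S) f := by
  induction S with
  | zero => simp [sigma]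
  | succ S ih => rw [Finset.sum_range_succ, ih, sigma]; abel

lemma continuous_sigma (s : ℕ) {f : Torus d → ℂ} (hf : Integrable f (μ d)) :
    Continuous (sigma s f) := by
  rw [sigma_eq_trigPoly s hf (B := box d (2 ^ (s + 1))) fun n hn => mem_box.2 hn.le]
  fun_prop

/-! ### Random selection -/

/-- For a centred random variable bounded by `B` the linear term averages out, leaving the
subgaussian bound `E e^Y ≤ e^{B²}`. -/
lemma exp_le_add_exp_sq (y : ℝ) : Real.exp y ≤ y + Real.exp (y ^ 2) := by
  have h1 := Real.add_one_le_exp (y ^ 2)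
  rcases le_total |y| 1 with h | h
  · have := (abs_le.1 (Real.abs_exp_sub_one_sub_id_le h)).2
    linarith
  · rcases le_abs.1 h with h | h
    · have : Real.exp y ≤ Real.exp (y ^ 2) := Real.exp_le_exp.2 (by nlinarith)
      linarith
    · have : Real.exp y ≤ 1 := Real.exp_le_one_iff.2 (by linarith)
      nlinarith

lemma integrable_of_continuous_real {f : Torus d → ℝ} (hf : Continuous f) : Integrable f (μ d) :=
  hf.integrable_of_hasCompactSupport (HasCompactSupport.of_compactSpace f)

/-- Averaging over independent choices: some choice of `m` indices keeps the exponential moments of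
the sums as small as they are on average. -/
lemma exists_selection {ι J : Type*} [Fintype ι] [Fintype J] {w : ι → ℝ} (hw : ∀ i, 0 ≤ w i)
    (hw1 : ∑ i, w i = 1) {Y : ι → J → Torus d → ℝ} (hc : ∀ i j, Continuous (Y i j)) {B : ℝ}
    (hB : ∀ i j x, |Y i j x| ≤ B) (h0 : ∀ j x, ∑ i, w i * Y i j x = 0) (m : ℕ) :
    ∃ k : Fin m → ι, ∑ j, ∫ x, Real.exp (∑ t, Y (k t) j x) ∂(μ d) ≤
      Fintype.card J * Real.exp (m * B ^ 2) := by
  classical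
  set R := Fintype.card J * Real.exp (m * B ^ 2) with hR
  set Φ : (Fin m → ι) → ℝ := fun k => ∑ j, ∫ x, Real.exp (∑ t, Y (k t) j x) ∂(μ d) with hΦ
  set W : (Fin m → ι) → ℝ := fun k => ∏ t, w (k t) with hW
  have hW0 : ∀ k, 0 ≤ W k := fun k => Finset.prod_nonneg fun _ _ => hw _
  have hWs : ∑ k, W k = 1 := by
    have := Finset.prod_univ_sum (fun _ : Fin m => (Finset.univ : Finset ι)) fun _ i => w i
    simp only [hw1, Finset.prod_const_one, Fintype.piFinset_univ] at this
    exact this.symm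
  -- Independence: the average over `m`-tuples of the exponential of a sum is the `m`-th power of a
  -- single average.
  have hpt : ∀ j x, ∑ k, W k * Real.exp (∑ t, Y (k t) j x) ≤ Real.exp (m * B ^ 2) := by
    intro j x
    have := Finset.prod_univ_sum (fun _ : Fin m => (Finset.univ : Finset ι))
      fun _ i => w i * Real.exp (Y i j x)
    rw [Fintype.piFinset_univ] at this
    simp only [Finset.prod_mul_distrib, ← Real.exp_sum] at this
    rw [← this, Finset.prod_const, Finset.card_univ, Fintype.card_fin, Real.exp_nat_mul]
    refine pow_le_pow_left₀
      (Finset.sum_nonneg fun i _ => mul_nonneg (hw i) (Real.exp_pos _).le) ?_ m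
    calc ∑ i, w i * Real.exp (Y i j x) ≤ ∑ i, (w i * Y i j x + w i * Real.exp (B ^ 2)) := by
          refine Finset.sum_le_sum fun i _ => ?_
          rw [← mul_add]
          refine mul_le_mul_of_nonneg_left ((exp_le_add_exp_sq _).trans ?_) (hw i)
          have : Y i j x ^ 2 ≤ B ^ 2 := sq_le_sq' (neg_le_of_abs_le (hB i j x))
            (le_of_abs_le (hB i j x))
          gcongr
      _ = Real.exp (B ^ 2) := by
          rw [Finset.sum_add_distrib, h0, ← Finset.sum_mul, hw1, zero_add, one_mul]
  have hcont : ∀ (k : Fin m → ι) (j : J), Continuous fun x => Real.exp (∑ t, Y (k t) j x) :=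
    fun k j => Real.continuous_exp.comp (continuous_finsetSum _ fun t _ => hc _ _)
  have hsum : ∑ k, W k * Φ k ≤ R := by
    calc ∑ k, W k * Φ k = ∑ j, ∫ x, ∑ k, W k * Real.exp (∑ t, Y (k t) j x) ∂(μ d) := by
          simp only [hΦ, Finset.mul_sum]
          rw [Finset.sum_comm]
          refine Finset.sum_congr rfl fun j _ => ?_
          rw [integral_finsetSum _ fun k _ =>
            (integrable_of_continuous_real (hcont k j)).const_mul _]
          simp only [integral_const_mul]
      _ ≤ ∑ j : J, Real.exp (m * B ^ 2) := by
          refine Finset.sum_le_sum fun j _ => ?_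
          calc _ ≤ ∫ x, Real.exp (m * B ^ 2) ∂(μ d) := by
                refine integral_mono ?_ (integrable_const _) (hpt j)
                exact integrable_finsetSum _ fun k _ =>
                  (integrable_of_continuous_real (hcont k j)).const_mul _
            _ = _ := by simp
      _ = R := by simp [hR]
  -- If every choice exceeded `R`, so would the weighted average; a choice of positive weight makes
  -- the inequality strict.
  by_contra! hlt
  obtain ⟨k0, hk0⟩ : ∃ k, 0 < W k := by
    by_contra! h
    have : ∑ k, W k ≤ 0 := Finset.sum_nonpos fun k _ => h k
    linarith
  have : ∑ k, W k * R < ∑ k, W k * Φ k :=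
    Finset.sum_lt_sum (fun k _ => mul_le_mul_of_nonneg_left (hlt k).le (hW0 k))
      ⟨k0, Finset.mem_univ _, mul_lt_mul_of_pos_left (hlt k0) hk0⟩
  rw [← Finset.sum_mul, hWs] at this
  linarith

lemma abs_pow_le_exp_add_exp (y : ℝ) (L : ℕ) :
    |y| ^ L ≤ L.factorial * (Real.exp y + Real.exp (-y)) := by
  have h := Real.pow_div_factorial_le_exp |y| (abs_nonneg y) L
  rw [div_le_iff₀' (by positivity)] at h
  refine h.trans (mul_le_mul_of_nonneg_left ?_ (by positivity))
  rcases abs_cases y with ⟨h, _⟩ | ⟨h, _⟩ <;> rw [h] <;>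
    linarith [Real.exp_pos y, Real.exp_pos (-y)]

/-- The four functionals `±Re`, `±Im`. -/
def quadrant : Fin 4 → ℂ → ℝ := ![fun z => z.re, fun z => -z.re, fun z => z.im, fun z => -z.im]

lemma abs_quadrant_le (a : Fin 4) (z : ℂ) : |quadrant a z| ≤ ‖z‖ := by
  fin_cases a <;> simp [quadrant, Complex.abs_re_le_norm, Complex.abs_im_le_norm]

lemma continuous_quadrant (a : Fin 4) : Continuous (quadrant a) := by
  fin_cases a <;> simp [quadrant] <;> fun_prop

lemma quadrant_sum {ι : Type*} (s : Finset ι) (a : Fin 4) (f : ι → ℂ) :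
    quadrant a (∑ i ∈ s, f i) = ∑ i ∈ s, quadrant a (f i) := by
  fin_cases a <;> simp [quadrant]

lemma quadrant_real_mul (a : Fin 4) (t : ℝ) (z : ℂ) : quadrant a (t * z) = t * quadrant a z := by
  fin_cases a <;> simp [quadrant]

lemma norm_pow_le_sum_exp_quadrant (z : ℂ) (L : ℕ) :
    ‖z‖ ^ L ≤ 2 ^ L * L.factorial * ∑ a, Real.exp (quadrant a z) := by
  calc ‖z‖ ^ L ≤ (|z.re| + |z.im|) ^ L := by
        gcongr; exact Complex.norm_le_abs_re_add_abs_im z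
    _ ≤ 2 ^ (L - 1) * (|z.re| ^ L + |z.im| ^ L) := add_pow_le (abs_nonneg _) (abs_nonneg _) L
    _ ≤ 2 ^ L * (L.factorial * (Real.exp z.re + Real.exp (-z.re)) +
          L.factorial * (Real.exp z.im + Real.exp (-z.im))) := by
        gcongr
        · norm_num
        · omega
        · exact abs_pow_le_exp_add_exp _ _
        · exact abs_pow_le_exp_add_exp _ _
    _ = _ := by
        simp only [Fin.sum_univ_four, quadrant, Matrix.cons_val]
        ring

/-- Exponential moments of `±Re G` and `±Im G` dominate the `L`-th moment of `|G|`, since `u^L ≤ L!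
e^u` for `u ≥ 0`. -/
lemma eLpNorm_le_of_integral_exp_le {G : Torus d → ℂ} (hG : Continuous G) {R : ℝ}
    (h : ∀ a, ∫ x, Real.exp (quadrant a (G x)) ∂(μ d) ≤ R) {L : ℕ} (hL : L ≠ 0) :
    eLpNorm G L (μ d) ≤ ENNReal.ofReal ((2 ^ L * L.factorial * (4 * R)) ^ ((L : ℝ)⁻¹)) := by
  have hL' : (L : ℝ≥0∞) ≠ 0 := by exact_mod_cast hL
  have hm : MemLp G L (μ d) :=
    (BoundedContinuousFunction.mkOfCompact ⟨G, hG⟩).memLp_top.mono_exponent le_top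
  rw [hm.eLpNorm_eq_integral_rpow_norm hL' (ENNReal.natCast_ne_top L)]
  simp only [ENNReal.toReal_natCast, Real.rpow_natCast]
  have hi : ∀ a, Integrable (fun x => Real.exp (quadrant a (G x))) (μ d) := fun a =>
    integrable_of_continuous_real
      (Real.continuous_exp.comp ((continuous_quadrant a).comp hG))
  refine ENNReal.ofReal_le_ofReal (Real.rpow_le_rpow (by positivity) ?_ (by positivity))
  calc ∫ x, ‖G x‖ ^ L ∂(μ d)
      ≤ ∫ x, 2 ^ L * L.factorial * ∑ a, Real.exp (quadrant a (G x)) ∂(μ d) := by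
        refine integral_mono (integrable_of_continuous_real (by fun_prop)) ?_
          fun x => norm_pow_le_sum_exp_quadrant _ _
        exact (integrable_finsetSum _ fun a _ => hi a).const_mul _
    _ = 2 ^ L * L.factorial * ∑ a, ∫ x, Real.exp (quadrant a (G x)) ∂(μ d) := by
        rw [integral_const_mul, integral_finsetSum _ fun a _ => hi a]
    _ ≤ 2 ^ L * L.factorial * ∑ a : Fin 4, R := by
        gcongr with a; exact h a
    _ = _ := by simp

/-- Centred functions of modulus at most two admit, in `L_q`, sums of `m` terms of size `√m`. -/
lemma exists_selection_eLpNorm (J : Type) [Fintype J] {q : ℝ≥0∞} (hq : q ≠ ∞) :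
    ∃ C : ℝ, 0 < C ∧ ∀ (ι : Type) [Fintype ι] (w : ι → ℝ) (_ : ∀ i, 0 ≤ w i)
      (_ : ∑ i, w i = 1) (X : ι → J → Torus d → ℂ) (_ : ∀ i j, Continuous (X i j))
      (_ : ∀ i j x, ‖X i j x‖ ≤ 2) (_ : ∀ j x, ∑ i, w i * X i j x = 0) (m : ℕ) (_ : 0 < m),
      ∃ k : Fin m → ι, ∀ j,
        eLpNorm (fun x => ∑ t, X (k t) j x) q (μ d) ≤ ENNReal.ofReal (C * √m) := by
  obtain ⟨L, hqL⟩ := ENNReal.exists_nat_gt hq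
  have hL : L ≠ 0 := by rintro rfl; simp at hqL
  set R : ℝ := Fintype.card (J × Fin 4) * Real.exp 4 with hR
  set C : ℝ := (2 ^ L * L.factorial * (4 * R)) ^ ((L : ℝ)⁻¹) with hC
  refine ⟨C + 1, by positivity, ?_⟩
  intro ι _ w hw hw1 X hXc hX h0 m hm
  have hm' : (0 : ℝ) < √m := Real.sqrt_pos.2 (by exact_mod_cast hm)
  -- Scaling by `m^{-1/2}` gives `B = 2 m^{-1/2}` and `m B² = 4`, which explains `exp 4` in `R`. The
  -- index set `J × Fin 4` treats all multipliers and all four functionals with a single choice.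
  obtain ⟨k, hk⟩ := exists_selection hw hw1
    (Y := fun i (ja : J × Fin 4) x => quadrant ja.2 ((((√m)⁻¹ : ℝ) : ℂ) * X i ja.1 x))
    (fun i ja => (continuous_quadrant _).comp (continuous_const.mul (hXc i ja.1)))
    (B := (√m)⁻¹ * 2)
    (fun i ja x => by
      refine (abs_quadrant_le _ _).trans ?_
      rw [norm_mul, Complex.norm_real, Real.norm_of_nonneg (by positivity)]
      gcongr
      exact hX _ _ _)
    (fun ja x => by
      have h1 := h0 ja.1 x
      have h2 := congrArg (fun z => quadrant ja.2 ((((√m)⁻¹ : ℝ) : ℂ) * z)) h1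
      simp only [quadrant_real_mul, quadrant_sum, mul_zero] at h2 ⊢
      have h3 : quadrant ja.2 0 = 0 := by
        have := quadrant_sum ∅ ja.2 (fun _ : ι => (0 : ℂ)); simpa using this
      rw [h3, Finset.mul_sum] at h2
      rw [← h2]
      refine Finset.sum_congr rfl fun i _ => ?_
      ring) m
  refine ⟨k, fun j => ?_⟩
  have hB : (m : ℝ) * ((√m)⁻¹ * 2) ^ 2 = 4 := by
    rw [mul_pow, inv_pow, Real.sq_sqrt (by positivity)]
    have : (m : ℝ) ≠ 0 := by positivity
    field_simp; norm_num
  rw [hB] at hk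
  set G : Torus d → ℂ := fun x => (((√m)⁻¹ : ℝ) : ℂ) * ∑ t, X (k t) j x with hG
  have hGc : Continuous G := continuous_const.mul (continuous_finsetSum _ fun t _ => hXc _ _)
  have hGL := eLpNorm_le_of_integral_exp_le hGc (R := R) (fun a => by
    refine le_trans ?_ hk
    refine le_trans (le_of_eq ?_) (Finset.single_le_sum
      (f := fun ja : J × Fin 4 => ∫ x, Real.exp (∑ t, quadrant ja.2
        ((((√m)⁻¹ : ℝ) : ℂ) * X (k t) ja.1 x)) ∂(μ d))
      (fun ja _ => integral_nonneg fun x => (Real.exp_pos _).le) (Finset.mem_univ (j, a)))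
    simp only [hG, Finset.mul_sum, quadrant_sum]) hL
  have hXG : (fun x => ∑ t, X (k t) j x) = ((√m : ℝ) : ℂ) • G := by
    ext x
    simp only [hG, Pi.smul_apply, smul_eq_mul, ← mul_assoc, ← Complex.ofReal_mul]
    rw [mul_inv_cancel₀ hm'.ne']; simp
  rw [hXG, eLpNorm_const_smul, mul_comm, ENNReal.ofReal_mul (by positivity)]
  refine mul_le_mul' ?_ (le_of_eq ?_)
  · refine (eLpNorm_le_eLpNorm_of_exponent_le hqL.le hGc.aestronglyMeasurable).trans
      (hGL.trans (ENNReal.ofReal_le_ofReal (by linarith)))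
  · rw [← ofReal_norm, Complex.norm_real, Real.norm_of_nonneg hm'.le]

lemma norm_trigPoly_le (K : Finset (Fin d → ℤ)) (c : (Fin d → ℤ) → ℂ) (x : Torus d) :
    ‖trigPoly K c x‖ ≤ ∑ n ∈ K, ‖c n‖ :=
  (norm_sum_le _ _).trans (Finset.sum_le_sum fun n _ => by simp)

lemma eLpNorm_le_of_norm_le {f : Torus d → ℂ} {A : ℝ} (h : ∀ x, ‖f x‖ ≤ A) (q : ℝ≥0∞) :
    eLpNorm f q (μ d) ≤ ENNReal.ofReal A := by
  simpa using eLpNorm_le_of_ae_bound (p := q) (.of_forall h : ∀ᵐ x ∂(μ d), ‖f x‖ ≤ A)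

/-- Sparse approximation in `L_q` of a trigonometric polynomial with absolute coefficient sum `A`
by `M` of its frequencies, with error of order `A M^{-1/2}`, simultaneously for the images of the
polynomial and the approximant under finitely many multipliers. -/
lemma exists_sparse_approx (d : ℕ) (J : Type) [Fintype J] {q : ℝ≥0∞} (hq : q ≠ ∞) :
    ∃ C : ℝ, 0 < C ∧ ∀ (K : Finset (Fin d → ℤ)) (c : (Fin d → ℤ) → ℂ)
      (a : J → (Fin d → ℤ) → ℝ) (_ : ∀ j n, |a j n| ≤ 1) (M : ℝ) (_ : 0 < M),
      ∃ (Θ : Finset (Fin d → ℤ)) (c' : (Fin d → ℤ) → ℂ), (Θ.card : ℝ) ≤ M ∧ Θ ⊆ K ∧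
        (∀ n ∉ Θ, c' n = 0) ∧ ∀ j, eLpNorm (trigPoly K fun n => a j n * (c n - c' n)) q (μ d) ≤
          ENNReal.ofReal (C * (∑ n ∈ K, ‖c n‖) * M ^ (-(1 / 2) : ℝ)) := by
  classical
  obtain ⟨C₀, hC₀, hsel⟩ := exists_selection_eLpNorm (d := d) J hq
  refine ⟨√2 * C₀ + 1, by positivity, ?_⟩
  intro K c a ha M hM
  set A := ∑ n ∈ K, ‖c n‖ with hA
  have hA0 : 0 ≤ A := Finset.sum_nonneg fun _ _ => norm_nonneg _
  have hMp : 0 < M ^ (-(1 / 2) : ℝ) := Real.rpow_pos_of_pos hM _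
  have hbound : ∀ j x, ‖trigPoly K (fun n => a j n * c n) x‖ ≤ A := by
    intro j x
    refine (norm_trigPoly_le _ _ _).trans (Finset.sum_le_sum fun n _ => ?_)
    rw [norm_mul, Complex.norm_real]
    exact mul_le_of_le_one_left (norm_nonneg _) (ha j n)
  -- The zero approximant is good enough when `A = 0` or `M < 1`.
  have htriv : A ≤ (√2 * C₀ + 1) * A * M ^ (-(1 / 2) : ℝ) →
      ∃ (Θ : Finset (Fin d → ℤ)) (c' : (Fin d → ℤ) → ℂ), (Θ.card : ℝ) ≤ M ∧ Θ ⊆ K ∧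
        (∀ n ∉ Θ, c' n = 0) ∧ ∀ j, eLpNorm (trigPoly K fun n => a j n * (c n - c' n)) q (μ d) ≤
          ENNReal.ofReal ((√2 * C₀ + 1) * A * M ^ (-(1 / 2) : ℝ)) := by
    intro h
    refine ⟨∅, 0, by simpa using hM.le, Finset.empty_subset _, fun _ _ => rfl, fun j => ?_⟩
    refine eLpNorm_le_of_norm_le (fun x => ?_) q
    simpa using (hbound j x).trans h
  rcases hA0.eq_or_lt with hAz | hApos
  · exact htriv (by rw [← hAz]; simp)
  rcases lt_or_ge M 1 with hM1 | hM1
  · refine htriv ?_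
    have h1 : 1 ≤ M ^ (-(1 / 2) : ℝ) :=
      Real.one_le_rpow_of_pos_of_le_one_of_nonpos hM hM1.le (by norm_num)
    have h2 : 1 ≤ √2 * C₀ + 1 := by have : 0 ≤ √2 * C₀ := by positivity
                                    linarith
    calc A = 1 * A * 1 := by ring
      _ ≤ _ := by gcongr
  set m := ⌊M⌋₊ with hm
  have hm0 : 0 < m := Nat.floor_pos.2 hM1
  have hmM : (m : ℝ) ≤ M := Nat.floor_le hM.le
  have hMm : M ≤ 2 * m := by
    have := Nat.lt_floor_add_one M
    have h1 : (1 : ℝ) ≤ m := by exact_mod_cast hm0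
    linarith
  -- The phase of `c n`, equal to `0` by the division convention when `c n = 0`.
  set u : (Fin d → ℤ) → ℂ := fun n => c n / ‖c n‖ with hu
  have hun : ∀ n, ‖u n‖ ≤ 1 := by
    intro n
    simp only [hu, norm_div, Complex.norm_real, norm_norm]
    exact div_self_le_one _
  have huc : ∀ n, (‖c n‖ : ℂ) * u n = c n := by
    intro n
    by_cases h : c n = 0
    · simp [h]
    · have : (‖c n‖ : ℂ) ≠ 0 := by simpa using h
      simp only [hu]; field_simp
  have hAC : (A : ℂ) ≠ 0 := by exact_mod_cast hApos.ne'
  -- With probabilities `|c_n| / A`, the mean of `a_j(n) u_n e^{i(n,x)}` is `A⁻¹` times the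
  -- polynomial with multiplier `a_j`. Subtracting it centres the variable.
  set X : K → J → Torus d → ℂ := fun i j x => a j i * u i * expo i x -
    (A : ℂ)⁻¹ * trigPoly K (fun n => a j n * c n) x with hX
  obtain ⟨k, hk⟩ := hsel K (fun i => ‖c i‖ / A) (fun i => by positivity)
    (by rw [← Finset.sum_div, Finset.sum_coe_sort K fun n => ‖c n‖, div_self hApos.ne'])
    X (fun i j => by simp only [hX]; fun_prop)
    (fun i j x => by
      simp only [hX]
      refine (norm_sub_le _ _).trans ?_
      have h1 : ‖(a j i : ℂ) * u i * expo i x‖ ≤ 1 := by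
        rw [norm_mul, norm_mul, norm_expo, mul_one, Complex.norm_real]
        exact mul_le_one₀ (ha j i) (norm_nonneg _) (hun i)
      have h2 : ‖(A : ℂ)⁻¹ * trigPoly K (fun n => a j n * c n) x‖ ≤ 1 := by
        rw [norm_mul, norm_inv, Complex.norm_real, Real.norm_of_nonneg hA0]
        exact inv_mul_le_one_of_le₀ (hbound j x) hA0
      linarith)
    (fun j x => by
      simp only [hX, mul_sub, Finset.sum_sub_distrib]
      rw [← Finset.sum_mul, sub_eq_zero]
      have h1 : ∑ i : K, ((‖c i‖ / A : ℝ) : ℂ) = 1 := by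
        rw [← Complex.ofReal_sum, ← Finset.sum_div, Finset.sum_coe_sort K fun n => ‖c n‖,
          div_self hApos.ne', Complex.ofReal_one]
      rw [h1, one_mul, trigPoly, Finset.mul_sum, ← Finset.sum_coe_sort K]
      refine Finset.sum_congr rfl fun i _ => ?_
      push_cast
      rw [← huc i]
      rw [div_eq_inv_mul]
      simp only [huc]
      linear_combination ((A : ℂ)⁻¹ * a j i * expo i x) * huc i) m hm0
  -- `A` times the empirical mean of the sample; a frequency drawn several times is counted with
  -- multiplicity.
  set c' : (Fin d → ℤ) → ℂ := fun n => (A / m : ℝ) * ∑ t, if (k t : Fin d → ℤ) = n then u n else 0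
    with hc'
  refine ⟨Finset.univ.image fun t => (k t : Fin d → ℤ), c', ?_, ?_, ?_, ?_⟩
  · refine le_trans ?_ hmM
    exact_mod_cast Finset.card_image_le.trans (by simp)
  · intro n hn
    obtain ⟨t, _, rfl⟩ := Finset.mem_image.1 hn
    exact (k t).2
  · intro n hn
    simp only [hc']
    rw [Finset.sum_eq_zero, mul_zero]
    intro t _
    rw [if_neg]
    rintro rfl
    exact hn (Finset.mem_image_of_mem _ (Finset.mem_univ t))
  · intro j
    have hmC : (m : ℂ) ≠ 0 := by exact_mod_cast hm0.ne'
    have hrep : (trigPoly K fun n => a j n * (c n - c' n)) =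
        (-(A / m : ℝ) : ℂ) • fun x => ∑ t, X (k t) j x := by
      ext x
      have h1 : trigPoly K (fun n => a j n * c' n) x =
          (A / m : ℝ) * ∑ t, (a j (k t) : ℂ) * u (k t) * expo (k t) x := by
        simp only [trigPoly, hc', Finset.mul_sum, Finset.sum_mul]
        rw [Finset.sum_comm]
        refine Finset.sum_congr rfl fun t _ => ?_
        rw [Finset.sum_eq_single (k t : Fin d → ℤ)]
        · simp; ring
        · intro n _ hn
          rw [if_neg hn.symm]; simp
        · intro h; exact absurd (k t).2 h
      have h2 : trigPoly K (fun n => a j n * (c n - c' n)) x =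
          trigPoly K (fun n => a j n * c n) x - trigPoly K (fun n => a j n * c' n) x := by
        simp only [trigPoly, ← Finset.sum_sub_distrib]
        exact Finset.sum_congr rfl fun n _ => by ring
      rw [h2, h1]
      simp only [hX, Pi.smul_apply, smul_eq_mul, Finset.sum_sub_distrib, Finset.sum_const,
        Finset.card_univ, Fintype.card_fin, nsmul_eq_mul]
      push_cast
      field_simp
      ring
    rw [hrep, eLpNorm_const_smul]
    calc ‖(-(A / m : ℝ) : ℂ)‖ₑ * eLpNorm (fun x => ∑ t, X (k t) j x) q (μ d)
        ≤ ENNReal.ofReal (A / m) * ENNReal.ofReal (C₀ * √m) := by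
          refine mul_le_mul' (le_of_eq ?_) (hk j)
          rw [enorm_neg, ← ofReal_norm, Complex.norm_real,
            Real.norm_of_nonneg (by positivity)]
      _ = ENNReal.ofReal (A / m * (C₀ * √m)) := (ENNReal.ofReal_mul (by positivity)).symm
      _ ≤ _ := by
          refine ENNReal.ofReal_le_ofReal ?_
          have h1 : M ^ (-(1 / 2) : ℝ) = (√M)⁻¹ := by
            rw [Real.rpow_neg hM.le, Real.sqrt_eq_rpow]
          have h2 : √M ≤ √2 * √m := by
            rw [← Real.sqrt_mul (by norm_num)]; exact Real.sqrt_le_sqrt hMm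
          have hsm : (0 : ℝ) < √m := Real.sqrt_pos.2 (by exact_mod_cast hm0)
          have hsM : 0 < √M := Real.sqrt_pos.2 hM
          have h3 : (√m)⁻¹ ≤ √2 * (√M)⁻¹ := by
            rw [← div_eq_mul_inv, le_div_iff₀ hsM, inv_mul_le_iff₀ hsm]
            linarith
          have h4 : A / m * (C₀ * √m) = C₀ * A * (√m)⁻¹ := by
            have : (m : ℝ) = √m * √m := (Real.mul_self_sqrt (by positivity)).symm
            rw [this]
            field_simp
            rw [Real.sq_sqrt (by positivity)]
          rw [h1, h4]
          calc C₀ * A * (√m)⁻¹ ≤ C₀ * A * (√2 * (√M)⁻¹) := by gcongr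
            _ = (√2 * C₀) * A * (√M)⁻¹ := by ring
            _ ≤ _ := by gcongr; linarith

/-! ### Fourier coefficients of functions of a Nikol'skii-Besov class -/

lemma modulus_mono {k : ℕ} {p : ℝ≥0∞} {f : Torus d → ℂ} {s t : ℝ} (h : s ≤ t) :
    modulus k p f s ≤ modulus k p f t :=
  iSup_mono fun _ => iSup_mono' fun hs => ⟨hs.trans h, le_rfl⟩

lemma le_ofReal_of_rpow_mul_le {t r A : ℝ} (ht : 0 < t) {a : ℝ≥0∞}
    (h : ENNReal.ofReal (t ^ (-r)) * a ≤ ENNReal.ofReal A) : a ≤ ENNReal.ofReal (A * t ^ r) := by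
  have h1 : ENNReal.ofReal (t ^ r) * ENNReal.ofReal (t ^ (-r)) = 1 := by
    rw [← ENNReal.ofReal_mul (by positivity), ← Real.rpow_add ht]; simp
  calc a = ENNReal.ofReal (t ^ r) * (ENNReal.ofReal (t ^ (-r)) * a) := by
        rw [← mul_assoc, h1, one_mul]
    _ ≤ ENNReal.ofReal (t ^ r) * ENNReal.ofReal A := by gcongr
    _ = _ := by rw [← ENNReal.ofReal_mul (by positivity), mul_comm]

/-- For `θ < ∞`, monotonicity of the modulus bounds the integrand on `(t, 2t]` from below by its
weights at `2t` and the modulus at `t`. -/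
lemma modulus_le_of_mem_besovClass {k : ℕ} {r : ℝ} (hr : 0 < r) {p θ : ℝ≥0∞} (hθ : 1 ≤ θ)
    {f : Torus d → ℂ} (hf : f ∈ besovClass d k r p θ) {t : ℝ} (ht : 0 < t) :
    modulus k p f t ≤ ENNReal.ofReal (2 * (2 * t) ^ r) := by
  have h : besovSeminorm k r p θ f ≤ 1 := le_trans le_add_self hf.2
  unfold besovSeminorm at h
  split_ifs at h with hinf
  · have h1 : ENNReal.ofReal (t ^ (-r)) * modulus k p f t ≤ ENNReal.ofReal 1 := by
      rw [ENNReal.ofReal_one]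
      exact (le_iSup₂ (f := fun (t : ℝ) (_ : 0 < t) =>
        ENNReal.ofReal (t ^ (-r)) * modulus k p f t) t ht).trans h
    refine (le_ofReal_of_rpow_mul_le ht h1).trans (ENNReal.ofReal_le_ofReal ?_)
    rw [Real.mul_rpow (by norm_num) ht.le]
    have : (1 : ℝ) ≤ 2 ^ r := Real.one_le_rpow (by norm_num) hr.le
    have h2 : 0 < t ^ r := by positivity
    nlinarith
  · have hθ1 : 1 ≤ θ.toReal := by
      rw [← ENNReal.toReal_one]
      exact ENNReal.toReal_mono hinf hθ
    have hθ0 : 0 < θ.toReal := by linarith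
    replace h := ENNReal.rpow_le_rpow h hθ0.le
    rw [← ENNReal.rpow_mul, one_div_mul_cancel hθ0.ne', ENNReal.rpow_one, ENNReal.one_rpow] at h
    set a := ENNReal.ofReal ((2 * t) ^ (-r)) * modulus k p f t with ha
    -- The interval `(t, 2t]` has length `t` and `1/u ≥ 1/(2t)` there, which gives the factor `1/2`;
    -- hence `a ≤ 2^{1/θ} ≤ 2`.
    have h1 : a ^ θ.toReal * ENNReal.ofReal (1 / 2) ≤ 1 := by
      calc a ^ θ.toReal * ENNReal.ofReal (1 / 2)
          = ∫⁻ _ in Ioc t (2 * t), a ^ θ.toReal * ENNReal.ofReal (2 * t)⁻¹ := by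
            rw [setLIntegral_const, Real.volume_Ioc, mul_assoc,
              ← ENNReal.ofReal_mul (by positivity)]
            congr 2
            field_simp; ring
        _ ≤ ∫⁻ u in Ioc t (2 * t), (ENNReal.ofReal (u ^ (-r)) * modulus k p f u) ^ θ.toReal
              * ENNReal.ofReal u⁻¹ := by
            refine setLIntegral_mono' measurableSet_Ioc fun u hu => ?_
            have hu0 : 0 < u := ht.trans hu.1
            refine mul_le_mul' (ENNReal.rpow_le_rpow (mul_le_mul' ?_ (modulus_mono hu.1.le))
              hθ0.le) ?_
            · refine ENNReal.ofReal_le_ofReal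
                (Real.rpow_le_rpow_of_nonpos hu0 hu.2 (by linarith))
            · exact ENNReal.ofReal_le_ofReal (inv_anti₀ hu0 hu.2)
        _ ≤ _ := lintegral_mono_set fun u hu => ht.trans hu.1
        _ ≤ 1 := h
    have h2 : a ^ θ.toReal ≤ 2 := by
      calc a ^ θ.toReal = a ^ θ.toReal * ENNReal.ofReal (1 / 2) * 2 := by
            rw [mul_assoc, ← ENNReal.ofReal_ofNat 2, ← ENNReal.ofReal_mul (by norm_num)]
            norm_num
        _ ≤ 1 * 2 := by gcongr
        _ = 2 := one_mul _
    have h3 : a ≤ ENNReal.ofReal 2 := by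
      rw [← ENNReal.le_rpow_inv_iff hθ0] at h2
      refine h2.trans ?_
      rw [ENNReal.ofReal_ofNat]
      calc (2 : ℝ≥0∞) ^ (θ.toReal)⁻¹ ≤ 2 ^ (1 : ℝ) :=
            ENNReal.rpow_le_rpow_of_exponent_le (by norm_num) (inv_le_one_of_one_le₀ hθ1)
        _ = 2 := ENNReal.rpow_one _
    exact le_ofReal_of_rpow_mul_le (by positivity) h3

lemma expo_toTorus_single (n : Fin d → ℤ) (j : Fin d) (t : ℝ) :
    expo n (toTorus (EuclideanSpace.single j t)) = Complex.exp (Complex.I * (n j * t : ℝ)) := by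
  rw [expo, Finset.prod_eq_single j]
  · simp only [toTorus, PiLp.single_apply, if_true]
    rw [fourier_coe_apply]
    congr 1
    push_cast
    field_simp
  · intro i _ hi
    simp [toTorus, hi]
  · simp

/-- `|e^{ix} - 1| = 2 |sin(x/2)|` and Jordan's inequality `sin u ≥ 2u/π`, with `2/π ≥ 1/2`. -/
lemma le_norm_exp_sub_one {x : ℝ} (h1 : 1 / 2 ≤ |x|) (h2 : |x| ≤ 1) :
    1 / 4 ≤ ‖Complex.exp (Complex.I * x) - 1‖ := by
  rw [Complex.norm_exp_I_mul_ofReal_sub_one, Real.norm_eq_abs, abs_mul, abs_two]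
  have h3 : |Real.sin (x / 2)| = Real.sin (|x| / 2) := by
    rcases abs_cases x with ⟨h, h'⟩ | ⟨h, h'⟩
    · rw [h, abs_of_nonneg]
      exact Real.sin_nonneg_of_nonneg_of_le_pi (by linarith)
        (by linarith [Real.pi_gt_three])
    · rw [h, neg_div, Real.sin_neg, abs_of_nonpos]
      exact Real.sin_nonpos_of_nonpos_of_neg_pi_le (by linarith)
        (by linarith [Real.pi_gt_three])
  rw [h3]
  have h4 := Real.mul_le_sin (x := |x| / 2) (by positivity) (by linarith [Real.pi_gt_three])
  have h5 : 1 / 2 ≤ 2 / π := by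
    rw [div_le_div_iff₀ (by norm_num) Real.pi_pos]; linarith [Real.pi_le_four]
  nlinarith

/-- Take the step `t = 2^{-s}` along the axis `j` where `|n_j| = |n|_∞`. Then `1/2 ≤ |n_j t| ≤ 1`,
so the `k`-th difference multiplies the coefficient by at least `4^{-k}` in modulus, and Parseval
applies to the difference. -/
lemma sum_sq_fc_coord_le {k : ℕ} {r : ℝ} (hr : 0 < r) {p θ : ℝ≥0∞} (hp : 2 ≤ p) (hθ : 1 ≤ θ)
    {f : Torus d → ℂ} (hf : f ∈ besovClass d k r p θ) {s : ℕ} (hs : 0 < s) (j : Fin d) :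
    ∑ n ∈ (block d s).filter (fun n => (n j).natAbs = supAbs n), ‖fc f n‖ ^ 2 ≤
      (4 ^ k * (2 * (2 * (2 ^ s)⁻¹) ^ r)) ^ 2 := by
  set t : ℝ := (2 ^ s)⁻¹ with ht
  have ht0 : 0 < t := by positivity
  set h : EuclideanSpace ℝ (Fin d) := EuclideanSpace.single j t with hh
  set g := (fwdDiff (toTorus h))^[k] f with hg
  have hgp : MemLp g p (μ d) := memLp_fwdDiff_iter hf.1 _ _
  have hg2 : MemLp g 2 (μ d) := hgp.mono_exponent hp
  have hnorm : eLpNorm g 2 (μ d) ≤ ENNReal.ofReal (2 * (2 * t) ^ r) := by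
    calc eLpNorm g 2 (μ d) ≤ eLpNorm g p (μ d) := eLpNorm_le_eLpNorm_of_exponent_le hp hgp.1
      _ ≤ modulus k p f t := by
          refine le_iSup₂ (f := fun (h : EuclideanSpace ℝ (Fin d)) (_ : ‖h‖ ≤ t) =>
            eLpNorm ((fwdDiff (toTorus h))^[k] f) p (μ d)) h ?_
          rw [hh, PiLp.norm_single, Real.norm_of_nonneg ht0.le]
      _ ≤ _ := modulus_le_of_mem_besovClass hr hθ hf ht0
  have hreal : (eLpNorm g 2 (μ d)).toReal ≤ 2 * (2 * t) ^ r :=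
    ENNReal.toReal_le_of_le_ofReal (by positivity) hnorm
  have hf1 : MemLp f 1 (μ d) := hf.1.mono_exponent (le_trans (by norm_num) hp)
  calc ∑ n ∈ (block d s).filter (fun n => (n j).natAbs = supAbs n), ‖fc f n‖ ^ 2
      ≤ ∑ n ∈ (block d s).filter (fun n => (n j).natAbs = supAbs n),
          (4 ^ k) ^ 2 * ‖fc g n‖ ^ 2 := by
        refine Finset.sum_le_sum fun n hn => ?_
        rw [Finset.mem_filter, mem_block] at hn
        rw [← mul_pow]
        refine pow_le_pow_left₀ (norm_nonneg _) ?_ 2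
        rw [hg, fc_fwdDiff_iter hf1, norm_mul, norm_pow, ← mul_assoc, ← mul_pow]
        refine le_mul_of_one_le_left (norm_nonneg _) (one_le_pow₀ ?_)
        rw [hh, expo_toTorus_single]
        have habs : |(n j : ℝ)| = supAbs n := by
          rw [← hn.2, Nat.cast_natAbs, Int.cast_abs]
        have hlo : (2 : ℝ) ^ s ≤ 2 * supAbs n := by
          have : 2 ^ (s - 1) ≤ supAbs n := lt_level_iff.1 (by omega)
          have h2 : 2 ^ s ≤ 2 * supAbs n := by
            calc 2 ^ s = 2 * 2 ^ (s - 1) := by rw [← pow_succ']; congr 1; omega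
              _ ≤ _ := by omega
          exact_mod_cast h2
        have hhi : (supAbs n : ℝ) ≤ 2 ^ s := by
          exact_mod_cast (level_le_iff.1 hn.1.le).le
        have := le_norm_exp_sub_one (x := n j * t)
          (by rw [abs_mul, habs, abs_of_pos ht0, ht, ← div_eq_mul_inv,
                div_le_div_iff₀ (by norm_num) (by positivity)]; linarith)
          (by rw [abs_mul, habs, abs_of_pos ht0, ht, ← div_eq_mul_inv,
                div_le_one (by positivity)]; exact hhi)
        linarith
    _ = (4 ^ k) ^ 2 * ∑ n ∈ (block d s).filter (fun n => (n j).natAbs = supAbs n),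
          ‖fc g n‖ ^ 2 := by rw [Finset.mul_sum]
    _ ≤ (4 ^ k) ^ 2 * (2 * (2 * t) ^ r) ^ 2 := by
        gcongr
        exact (sum_sq_fc_le hg2 _).trans (pow_le_pow_left₀ ENNReal.toReal_nonneg hreal 2)
    _ = _ := by ring

/-- Every nonzero frequency attains its maximum on one of the `d` axes; the extra `1` in `d + 1`
covers level `0`, where `‖f‖_2 ≤ 1` suffices. -/
lemma sum_sq_fc_block_le {k : ℕ} {r : ℝ} (hr : 0 < r) {p θ : ℝ≥0∞} (hp : 2 ≤ p) (hθ : 1 ≤ θ)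
    {f : Torus d → ℂ} (hf : f ∈ besovClass d k r p θ) (s : ℕ) :
    ∑ n ∈ block d s, ‖fc f n‖ ^ 2 ≤ (d + 1) * (4 ^ k * (2 * (2 * (2 ^ s)⁻¹) ^ r)) ^ 2 := by
  rcases Nat.eq_zero_or_pos s with rfl | hs
  · have h1 : (eLpNorm f 2 (μ d)).toReal ≤ 1 := by
      refine ENNReal.toReal_le_of_le_ofReal zero_le_one ?_
      rw [ENNReal.ofReal_one]
      exact (eLpNorm_le_eLpNorm_of_exponent_le hp hf.1.1).trans (le_trans le_self_add hf.2)
    have h2 : (1 : ℝ) ≤ 4 ^ k * (2 * (2 * (2 ^ 0)⁻¹) ^ r) := by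
      have h4 : (1 : ℝ) ≤ 4 ^ k := one_le_pow₀ (by norm_num)
      have h5 : (1 : ℝ) ≤ 2 ^ r := Real.one_le_rpow (by norm_num) hr.le
      simp only [pow_zero, inv_one, mul_one]
      nlinarith
    calc _ ≤ (eLpNorm f 2 (μ d)).toReal ^ 2 := sum_sq_fc_le (hf.1.mono_exponent hp) _
      _ ≤ 1 := pow_le_one₀ ENNReal.toReal_nonneg h1
      _ ≤ (4 ^ k * (2 * (2 * (2 ^ 0)⁻¹) ^ r)) ^ 2 := one_le_pow₀ h2
      _ ≤ _ := le_mul_of_one_le_left (by positivity) (by simp)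
  · calc ∑ n ∈ block d s, ‖fc f n‖ ^ 2
        ≤ ∑ j : Fin d, ∑ n ∈ (block d s).filter (fun n => (n j).natAbs = supAbs n),
            ‖fc f n‖ ^ 2 := by
          simp only [Finset.sum_filter]
          rw [Finset.sum_comm]
          refine Finset.sum_le_sum fun n hn => ?_
          rw [mem_block] at hn
          have : 0 < supAbs n := by
            have := lt_level_iff.1 (show 0 < level n by omega)
            rwa [pow_zero] at this
          obtain ⟨j, hj⟩ := exists_natAbs_eq_supAbs this
          have := Finset.single_le_sum (f := fun j =>
            if (n j).natAbs = supAbs n then ‖fc f n‖ ^ 2 else 0)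
            (fun j _ => by positivity) (Finset.mem_univ j)
          simpa [hj] using this
      _ ≤ ∑ j : Fin d, (4 ^ k * (2 * (2 * (2 ^ s)⁻¹) ^ r)) ^ 2 :=
          Finset.sum_le_sum fun j _ => sum_sq_fc_coord_le hr hp hθ hf hs j
      _ = d * (4 ^ k * (2 * (2 * (2 ^ s)⁻¹) ^ r)) ^ 2 := by simp
      _ ≤ _ := by gcongr; linarith

lemma two_mul_inv_two_pow_rpow (s : ℕ) (r : ℝ) :
    (2 * ((2 : ℝ) ^ s)⁻¹) ^ r = 2 ^ r * 2 ^ (-(s * r)) := by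
  rw [Real.mul_rpow (by norm_num) (by positivity), ← Real.rpow_natCast, ← Real.rpow_neg (by simp),
    ← Real.rpow_mul (by norm_num), neg_mul]

/-- Cauchy–Schwarz over at most `3^d 2^{sd}` frequencies costs the factor `2^{sd/2}`. -/
lemma exists_sum_norm_fc_block_le (d k : ℕ) {r : ℝ} (hr : 0 < r) {p θ : ℝ≥0∞} (hp : 2 ≤ p)
    (hθ : 1 ≤ θ) : ∃ C : ℝ, 0 < C ∧ ∀ f ∈ besovClass d k r p θ, ∀ s : ℕ,
      ∑ n ∈ block d s, ‖fc f n‖ ≤ C * 2 ^ (-(s * (r - d / 2)) : ℝ) := by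
  refine ⟨√(3 ^ d) * √(d + 1) * (4 ^ k * (2 * 2 ^ r)), by positivity, fun f hf s => ?_⟩
  have h1 : ∑ n ∈ block d s, ‖fc f n‖ ≤
      √((block d s).card) * √(∑ n ∈ block d s, ‖fc f n‖ ^ 2) := by
    rw [← Real.sqrt_mul (by positivity)]
    exact Real.le_sqrt_of_sq_le sq_sum_le_card_mul_sum_sq
  have h2 : √((block d s).card) ≤ √(3 ^ d) * 2 ^ (s * (d / 2 : ℝ)) := by
    have h3 : ((block d s).card : ℝ) ≤ 3 ^ d * 2 ^ (s * d) := by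
      exact_mod_cast card_block_le d s
    refine (Real.sqrt_le_sqrt h3).trans (le_of_eq ?_)
    rw [Real.sqrt_mul (by positivity)]
    congr 1
    rw [Real.sqrt_eq_rpow, ← Real.rpow_natCast, ← Real.rpow_mul (by norm_num)]
    congr 1; push_cast; ring
  have h3 : √(∑ n ∈ block d s, ‖fc f n‖ ^ 2) ≤
      √(d + 1) * (4 ^ k * (2 * (2 ^ r * 2 ^ (-(s * r))))) := by
    refine (Real.sqrt_le_sqrt (sum_sq_fc_block_le hr hp hθ hf s)).trans (le_of_eq ?_)
    rw [Real.sqrt_mul (by positivity), Real.sqrt_sq (by positivity), two_mul_inv_two_pow_rpow]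
  calc _ ≤ _ := h1
    _ ≤ (√(3 ^ d) * 2 ^ (s * (d / 2 : ℝ))) *
        (√(d + 1) * (4 ^ k * (2 * (2 ^ r * 2 ^ (-(s * r)))))) := by gcongr
    _ = √(3 ^ d) * √(d + 1) * (4 ^ k * (2 * 2 ^ r)) *
        (2 ^ (s * (d / 2 : ℝ)) * 2 ^ (-(s * r) : ℝ)) := by ring
    _ = _ := by
        rw [← Real.rpow_add (by norm_num)]
        congr 2; ring

/-! ### The embedding and the upper bound -/

/-- Block `s` contributes only to `σ_s` and `σ_{s-1}`, hence the factor `2`. -/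
lemma bq1Norm_le_two_mul_tsum {q : ℝ≥0∞} (hq : 1 ≤ q) {g : Torus d → ℂ} (hg : Integrable g (μ d))
    {E : ℕ → ℝ≥0∞} (hE : ∀ s s', s' = s ∨ s' + 1 = s →
      eLpNorm (trigPoly (block d s) fun n => sigmaMult s' n * fc g n) q (μ d) ≤ E s) :
    bq1Norm q g ≤ 2 * ∑' s, E s := by
  calc bq1Norm q g ≤ ∑' s, (E s + E (s + 1)) := by
        refine ENNReal.tsum_le_tsum fun s => ?_
        rw [sigma_eq_block s hg]
        exact (eLpNorm_add_le (continuous_trigPoly _ _).aestronglyMeasurable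
          (continuous_trigPoly _ _).aestronglyMeasurable hq).trans
          (add_le_add (hE s s (Or.inl rfl)) (hE (s + 1) s (Or.inr rfl)))
    _ = ∑' s, E s + ∑' s, E (s + 1) := ENNReal.tsum_add
    _ ≤ ∑' s, E s + ∑' s, E s :=
        add_le_add le_rfl (ENNReal.tsum_comp_le_tsum_of_injective (add_left_injective 1) E)
    _ = _ := (two_mul _).symm

lemma norm_trigPoly_sigmaMult_le (K : Finset (Fin d → ℤ)) (s : ℕ) (c : (Fin d → ℤ) → ℂ)
    (x : Torus d) : ‖trigPoly K (fun n => sigmaMult s n * c n) x‖ ≤ ∑ n ∈ K, ‖c n‖ := by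
  refine (norm_trigPoly_le _ _ _).trans (Finset.sum_le_sum fun n _ => ?_)
  rw [norm_mul, Complex.norm_real]
  exact mul_le_of_le_one_left (norm_nonneg _) (abs_sigmaMult_le s n)

lemma two_rpow_neg_mul_nat (s : ℕ) (a : ℝ) : (2 : ℝ) ^ (-(s * a) : ℝ) = (2 ^ (-a)) ^ s := by
  rw [← Real.rpow_natCast, ← Real.rpow_mul (by norm_num)]
  congr 1; ring

lemma exists_bq1Norm_le (d k : ℕ) {r : ℝ} (hr : (d : ℝ) / 2 < r) {p θ q : ℝ≥0∞} (hp : 2 ≤ p)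
    (hq : 1 ≤ q) (hθ : 1 ≤ θ) :
    ∃ C : ℝ, 0 < C ∧ ∀ f ∈ besovClass d k r p θ, MemLp f q (μ d) ∧
      bq1Norm q f ≤ ENNReal.ofReal C := by
  have hr0 : 0 < r := lt_of_le_of_lt (by positivity) hr
  obtain ⟨C, hC, hblock⟩ := exists_sum_norm_fc_block_le d k hr0 hp hθ
  set y : ℝ := 2 ^ (-(r - d / 2)) with hy
  have hy0 : 0 < y := by positivity
  have hy1 : y < 1 := Real.rpow_lt_one_of_one_lt_of_neg (by norm_num) (by linarith)
  have hgeo := hasSum_geometric_of_lt_one hy0.le hy1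
  have hy2 : 0 < (1 - y)⁻¹ := inv_pos.2 (by linarith)
  have hsum : ∑' s : ℕ, ENNReal.ofReal (C * y ^ s) = ENNReal.ofReal (C * (1 - y)⁻¹) := by
    rw [← ENNReal.ofReal_tsum_of_nonneg (fun s => by positivity) (hgeo.summable.mul_left C),
      (hgeo.mul_left C).tsum_eq]
  refine ⟨2 * (C * (1 - y)⁻¹), by positivity, fun f hf => ⟨?_, ?_⟩⟩
  · refine memLp_of_summable_fc (hf.1.mono_exponent hp) ?_ q
    refine summable_of_sum_le (c := C * (1 - y)⁻¹) (fun _ => norm_nonneg _) fun u => ?_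
    classical
    calc ∑ n ∈ u, ‖fc f n‖ = ∑ s ∈ u.image level, ∑ n ∈ u.filter (fun n => level n = s),
          ‖fc f n‖ :=
          (Finset.sum_fiberwise_of_maps_to (fun n hn => Finset.mem_image_of_mem _ hn) _).symm
      _ ≤ ∑ s ∈ u.image level, C * y ^ s := by
          refine Finset.sum_le_sum fun s _ => ?_
          rw [hy, ← two_rpow_neg_mul_nat]
          refine le_trans (Finset.sum_le_sum_of_subset_of_nonneg (fun n hn => ?_)
            fun _ _ _ => norm_nonneg _) (hblock f hf s)
          exact mem_block.2 (Finset.mem_filter.1 hn).2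
      _ ≤ _ := sum_le_hasSum _ (fun _ _ => by positivity) (hgeo.mul_left C)
  · refine (bq1Norm_le_two_mul_tsum hq
      (E := fun s => ENNReal.ofReal (C * y ^ s)) (hf.1.integrable (le_trans (by norm_num) hp))
      fun s s' _ => eLpNorm_le_of_norm_le (fun x => ?_) q).trans (le_of_eq ?_)
    · rw [hy, ← two_rpow_neg_mul_nat]
      exact (norm_trigPoly_sigmaMult_le _ _ _ _).trans (hblock f hf s)
    · rw [hsum, ENNReal.ofReal_mul (by norm_num : (0 : ℝ) ≤ 2), ENNReal.ofReal_ofNat]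

lemma exists_sparse_approx_besov (d k : ℕ) {r : ℝ} (hr : (d : ℝ) / 2 < r) {p θ q : ℝ≥0∞}
    (hp : 2 ≤ p) (hq : 1 ≤ q) (hq' : q ≠ ∞) (hθ : 1 ≤ θ) :
    ∃ A C : ℝ, 1 ≤ A ∧ 0 < C ∧ ∀ f ∈ besovClass d k r p θ, ∀ N : ℕ,
      ∃ (Θ : Finset (Fin d → ℤ)) (c : (Fin d → ℤ) → ℂ), (Θ.card : ℝ) ≤ A * (2 ^ d) ^ N ∧
        bq1Norm q (f - trigPoly Θ c) ≤ ENNReal.ofReal (C * 2 ^ (-(N * r))) := by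
  classical
  have hr0 : 0 < r := lt_of_le_of_lt (by positivity) hr
  obtain ⟨C₁, hC₁, hblock⟩ := exists_sum_norm_fc_block_le d k hr0 hp hθ
  obtain ⟨C₂, hC₂, hsparse⟩ := exists_sparse_approx d Bool hq'
  set κ : ℝ := r - d / 2 with hκ
  set y : ℝ := 2 ^ (-(κ / 2)) with hy
  have hy0 : 0 < y := by positivity
  have hy1 : y < 1 := Real.rpow_lt_one_of_one_lt_of_neg (by norm_num) (by linarith)
  have hyy0 : 0 < y ^ 2 := by positivity
  have hyy1 : y ^ 2 < 1 := pow_lt_one₀ hy0.le hy1 (by norm_num)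
  have hgeo := hasSum_geometric_of_lt_one hy0.le hy1
  have hgeo2 := hasSum_geometric_of_lt_one hyy0.le hyy1
  have hpos1 : 0 < (1 - y)⁻¹ := inv_pos.2 (by linarith)
  have hpos2 : 0 < (1 - y ^ 2)⁻¹ := inv_pos.2 (by linarith)
  refine ⟨3 ^ d + (1 - y ^ 2)⁻¹, 2 * (C₂ * C₁ * (1 - y)⁻¹), ?_, by positivity, ?_⟩
  · have : (1 : ℝ) ≤ 3 ^ d := one_le_pow₀ (by norm_num)
    linarith
  intro f hf N
  have hfi : Integrable f (μ d) := hf.1.integrable (le_trans (by norm_num) hp)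
  -- Here `y² = 2^{-κ}`. The coefficient sum on level `N + 1 + i` decays like `y^{2(i+1)}`, while a
  -- budget shrinking like `y^{2(i+1)}` loses `y^{-(i+1)}` in the error; both budgets and errors
  -- remain geometric.
  set M : ℕ → ℝ := fun i => (2 ^ d) ^ N * (y ^ 2) ^ (i + 1) with hM
  have hM0 : ∀ i, 0 < M i := fun i => by positivity
  have hex : ∀ i : ℕ, ∃ (Θ : Finset (Fin d → ℤ)) (c' : (Fin d → ℤ) → ℂ), (Θ.card : ℝ) ≤ M i ∧
      Θ ⊆ block d (N + 1 + i) ∧ (∀ n ∉ Θ, c' n = 0) ∧ ∀ s', s' = N + 1 + i ∨ s' + 1 = N + 1 + i →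
        eLpNorm (trigPoly (block d (N + 1 + i)) fun n => sigmaMult s' n * (fc f n - c' n)) q (μ d) ≤
          ENNReal.ofReal (C₂ * C₁ * 2 ^ (-(N * r)) * y ^ i) := by
    intro i
    -- The two multipliers are those of the only operators that see this block, `σ_{N+1+i}` and
    -- `σ_{N+i}`.
    obtain ⟨Θ, c', h1, h2, h3, h4⟩ := hsparse (block d (N + 1 + i)) (fc f)
      (fun j n => if j then sigmaMult (N + 1 + i) n else sigmaMult (N + i) n)
      (fun j n => by cases j <;> simp [abs_sigmaMult_le]) (M i) (hM0 i)
    refine ⟨Θ, c', h1, h2, h3, fun s' hs' => ?_⟩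
    have hle : C₂ * (∑ n ∈ block d (N + 1 + i), ‖fc f n‖) * M i ^ (-(1 / 2) : ℝ) ≤
        C₂ * C₁ * 2 ^ (-(N * r)) * y ^ i := by
      have e1 : M i ^ (-(1 / 2) : ℝ) = 2 ^ (-(N * (d / 2 : ℝ))) * (y ^ (i + 1))⁻¹ := by
        rw [hM]
        simp only
        rw [Real.mul_rpow (by positivity) (by positivity)]
        congr 1
        · rw [← pow_mul, ← Real.rpow_natCast, ← Real.rpow_mul (by norm_num)]
          congr 1; push_cast; ring
        · rw [← pow_mul, mul_comm 2, pow_mul, Real.rpow_neg (by positivity), ← Real.sqrt_eq_rpow,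
            Real.sqrt_sq (by positivity)]
      have e2 : (2 : ℝ) ^ (-((N + 1 + i : ℕ) * κ)) = 2 ^ (-(N * κ)) * (y ^ (i + 1)) ^ 2 := by
        rw [hy, ← pow_mul, ← Real.rpow_natCast, ← Real.rpow_mul (by norm_num),
          ← Real.rpow_add (by norm_num)]
        congr 1; push_cast; ring
      have e3 : (2 : ℝ) ^ (-(N * r)) = 2 ^ (-(N * κ)) * 2 ^ (-(N * (d / 2 : ℝ))) := by
        rw [← Real.rpow_add (by norm_num)]
        congr 1; rw [hκ]; ring
      have hb := hblock f hf (N + 1 + i)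
      rw [e2] at hb
      rw [e1, e3]
      calc C₂ * (∑ n ∈ block d (N + 1 + i), ‖fc f n‖) *
            (2 ^ (-(N * (d / 2 : ℝ))) * (y ^ (i + 1))⁻¹)
          ≤ C₂ * (C₁ * (2 ^ (-(N * κ)) * (y ^ (i + 1)) ^ 2)) *
            (2 ^ (-(N * (d / 2 : ℝ))) * (y ^ (i + 1))⁻¹) := by gcongr
        _ = C₂ * C₁ * (2 ^ (-(N * κ)) * 2 ^ (-(N * (d / 2 : ℝ)))) * y ^ (i + 1) := by
            have : y ^ (i + 1) ≠ 0 := by positivity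
            field_simp
        _ ≤ _ := by
            refine mul_le_mul_of_nonneg_left ?_ (by positivity)
            exact pow_le_pow_of_le_one hy0.le hy1.le (by omega)
    rcases hs' with rfl | hs'
    · exact (h4 true).trans (ENNReal.ofReal_le_ofReal hle)
    · obtain rfl : s' = N + i := by omega
      exact (h4 false).trans (ENNReal.ofReal_le_ofReal hle)
  choose Θ c' hcard hsub hzero herr using hex
  -- Once the budget is below `1` no frequency is selected, so the union of the `Θ i` is finite.
  obtain ⟨S, hS⟩ : ∃ S, ∀ i, S ≤ i → Θ i = ∅ := by
    obtain ⟨S, hS⟩ := exists_pow_lt_of_lt_one (show (0 : ℝ) < ((2 ^ d) ^ N)⁻¹ by positivity) hyy1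
    refine ⟨S, fun i hi => ?_⟩
    have h1 : M i < 1 := by
      calc M i ≤ (2 ^ d) ^ N * (y ^ 2) ^ S := by
            refine mul_le_mul_of_nonneg_left ?_ (by positivity)
            exact pow_le_pow_of_le_one hyy0.le hyy1.le (by omega)
        _ < (2 ^ d) ^ N * ((2 ^ d) ^ N)⁻¹ := by gcongr
        _ = 1 := mul_inv_cancel₀ (by positivity)
    have h2 : ((Θ i).card : ℝ) < 1 := (hcard i).trans_lt h1
    have h3 : (Θ i).card = 0 := by
      have : (Θ i).card < 1 := by exact_mod_cast h2
      omega
    exact Finset.card_eq_zero.1 h3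
  set Ω : Finset (Fin d → ℤ) := (box d (2 ^ N)).filter (fun n => level n ≤ N) ∪
    (Finset.range S).biUnion Θ with hΩ
  -- The truncated subtraction is exact where it is used, since there `level n ≥ N + 1`.
  set c : (Fin d → ℤ) → ℂ := fun n => if level n ≤ N then fc f n else c' (level n - (N + 1)) n
    with hc
  have hcoef : ∀ n, fc (f - trigPoly Ω c) n = fc f n - c n := by
    intro n
    rw [fc_sub hfi (integrable_of_continuous (continuous_trigPoly _ _)), fc_trigPoly]
    split_ifs with hn
    · rfl
    · congr 1
      rw [hΩ, Finset.mem_union, not_or, Finset.mem_filter, Finset.mem_biUnion] at hn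
      have h1 : ¬ level n ≤ N := fun h => hn.1 ⟨mem_box.2 (level_le_iff.1 h).le, h⟩
      rw [hc]
      simp only [if_neg h1]
      refine (hzero _ n fun h => ?_).symm
      by_cases h2 : level n - (N + 1) < S
      · exact hn.2 ⟨_, Finset.mem_range.2 h2, h⟩
      · rw [hS _ (by omega)] at h
        simp at h
  refine ⟨Ω, c, ?_, ?_⟩
  · have h1 : ((box d (2 ^ N)).card : ℝ) ≤ 3 ^ d * (2 ^ d) ^ N := by
      rw [card_box, ← pow_mul, mul_comm d N, pow_mul, ← mul_pow]
      push_cast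
      gcongr
      have : (1 : ℝ) ≤ 2 ^ N := one_le_pow₀ (by norm_num)
      linarith
    have h2 : (((Finset.range S).biUnion Θ).card : ℝ) ≤ (1 - y ^ 2)⁻¹ * (2 ^ d) ^ N := by
      calc (((Finset.range S).biUnion Θ).card : ℝ) ≤ ∑ i ∈ Finset.range S, ((Θ i).card : ℝ) := by
            exact_mod_cast Finset.card_biUnion_le
        _ ≤ ∑ i ∈ Finset.range S, (2 ^ d) ^ N * (y ^ 2) ^ i := by
            refine Finset.sum_le_sum fun i _ => (hcard i).trans ?_
            refine mul_le_mul_of_nonneg_left ?_ (by positivity)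
            exact pow_le_pow_of_le_one hyy0.le hyy1.le (by omega)
        _ ≤ (2 ^ d) ^ N * (1 - y ^ 2)⁻¹ :=
            sum_le_hasSum _ (fun _ _ => by positivity) (hgeo2.mul_left _)
        _ = _ := mul_comm _ _
    have h3 : (Ω.card : ℝ) ≤ (box d (2 ^ N)).card + ((Finset.range S).biUnion Θ).card := by
      exact_mod_cast (Finset.card_union_le _ _).trans
        (Nat.add_le_add_right (Finset.card_filter_le _ _) _)
    calc _ ≤ _ := h3
      _ ≤ 3 ^ d * (2 ^ d) ^ N + (1 - y ^ 2)⁻¹ * (2 ^ d) ^ N := add_le_add h1 h2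
      _ = _ := by ring
  · set E : ℕ → ℝ≥0∞ := fun s => if s ≤ N then 0 else
      ENNReal.ofReal (C₂ * C₁ * 2 ^ (-(N * r)) * y ^ (s - (N + 1))) with hE
    have hEsum : ∑' s, E s = ENNReal.ofReal (C₂ * C₁ * 2 ^ (-(N * r)) * (1 - y)⁻¹) := by
      rw [← ENNReal.summable.sum_add_tsum_nat_add' (k := N + 1) (f := E), Finset.sum_eq_zero,
        zero_add, ← (hgeo.mul_left _).tsum_eq, ENNReal.ofReal_tsum_of_nonneg
          (fun s => by positivity) (hgeo.summable.mul_left _)]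
      · refine tsum_congr fun i => ?_
        simp only [hE]
        rw [if_neg (by omega), Nat.add_sub_cancel]
      · intro s hs
        simp only [hE]
        rw [if_pos (by have := Finset.mem_range.1 hs; omega)]
    refine (bq1Norm_le_two_mul_tsum hq (E := E)
      (hfi.sub (integrable_of_continuous (continuous_trigPoly _ _))) ?_).trans (le_of_eq ?_)
    · intro s s' hs'
      simp only [hE]
      split_ifs with hsN
      · have : (trigPoly (block d s) fun n => (sigmaMult s' n : ℂ) * fc (f - trigPoly Ω c) n) =
            0 := by
          ext x
          refine Finset.sum_eq_zero fun n hn => ?_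
          rw [mem_block] at hn
          simp only [hcoef]
          simp [hc, hn, hsN]
        rw [this, eLpNorm_zero]
      · obtain ⟨i, rfl⟩ : ∃ i, s = N + 1 + i := ⟨s - (N + 1), by omega⟩
        have : (trigPoly (block d (N + 1 + i)) fun n =>
            (sigmaMult s' n : ℂ) * fc (f - trigPoly Ω c) n) =
            trigPoly (block d (N + 1 + i)) fun n => sigmaMult s' n * (fc f n - c' i n) := by
          ext x
          refine Finset.sum_congr rfl fun n hn => ?_
          rw [mem_block] at hn
          simp only [hcoef]
          simp only [hc, hn, if_neg hsN, Nat.add_sub_cancel_left]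
        rw [this, Nat.add_sub_cancel_left]
        exact herr i s' hs'
    · rw [hEsum, ← ENNReal.ofReal_ofNat 2, ← ENNReal.ofReal_mul (by norm_num)]
      congr 1; ring

/-- The definition asks for exactly `m` frequencies. As `ℤ^d` is infinite for `d > 0`, a smaller set
can be padded with zero coefficients. -/
lemma bestApprox_le {N : (Torus d → ℂ) → ℝ≥0∞} {m : ℕ} {f : Torus d → ℂ} (hd : 0 < d)
    {Θ : Finset (Fin d → ℤ)} (hΘ : Θ.card ≤ m) (c : (Fin d → ℤ) → ℂ) :
    bestApprox N m f ≤ N (f - trigPoly Θ c) := by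
  classical
  have : Nonempty (Fin d) := ⟨⟨0, hd⟩⟩
  obtain ⟨Θ', hsub, hcard⟩ := Infinite.exists_superset_card_eq Θ m hΘ
  have h : trigPoly Θ c = trigPoly Θ' fun n => if n ∈ Θ then c n else 0 := by
    ext x
    simp only [trigPoly, ite_mul, zero_mul, Finset.sum_ite_mem]
    rw [Finset.inter_eq_right.2 hsub]
  rw [h]
  exact iInf₂_le_of_le Θ' hcard (iInf_le _ _)

lemma exists_bestApproxClass_le (k : ℕ) (hd : 0 < d) {r : ℝ} (hr : (d : ℝ) / 2 < r)
    {p θ q : ℝ≥0∞} (hp : 2 ≤ p) (hq : 1 ≤ q) (hq' : q ≠ ∞) (hθ : 1 ≤ θ) :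
    ∃ C : ℝ, 0 < C ∧ ∀ m : ℕ, 1 ≤ m →
      bestApproxClass (bq1Norm q) m (besovClass d k r p θ) ≤
        ENNReal.ofReal (C * (m : ℝ) ^ (-(r / d))) := by
  have hr0 : 0 < r := lt_of_le_of_lt (by positivity) hr
  have hd' : (0 : ℝ) < d := by exact_mod_cast hd
  obtain ⟨C₀, hC₀, hbd⟩ := exists_bq1Norm_le d k hr hp hq hθ
  obtain ⟨A, C₁, hA, hC₁, hsp⟩ := exists_sparse_approx_besov d k hr hp hq hq' hθ
  have hA0 : 0 < A := by linarith
  have hrd : 0 < r / d := by positivity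
  refine ⟨C₀ * A ^ (r / d) + C₁ * (A * 2 ^ d) ^ (r / d), by positivity, fun m hm => ?_⟩
  have hm0 : (0 : ℝ) < m := by exact_mod_cast hm
  have key : ∀ B : ℝ, 0 < B → (B * (m : ℝ)⁻¹) ^ (r / d) = B ^ (r / d) * (m : ℝ) ^ (-(r / d)) := by
    intro B hB
    rw [Real.mul_rpow hB.le (by positivity), Real.inv_rpow hm0.le, Real.rpow_neg hm0.le]
  refine iSup₂_le fun f hf => ?_
  -- For `m < A` there is no room for the construction with `N = 0`; approximation by zero suffices,
  -- as `m` is bounded.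
  rcases lt_or_ge (m : ℝ) A with hmA | hmA
  · refine (bestApprox_le hd (Θ := ∅) (by simp) 0).trans ?_
    have : f - trigPoly ∅ 0 = f := by ext x; simp [trigPoly]
    rw [this]
    refine (hbd f hf).2.trans (ENNReal.ofReal_le_ofReal ?_)
    have h1 : 1 ≤ A ^ (r / d) * (m : ℝ) ^ (-(r / d)) := by
      rw [← key A hA0]
      refine Real.one_le_rpow ?_ hrd.le
      rw [← div_eq_mul_inv, one_le_div hm0]; exact hmA.le
    calc C₀ = C₀ * 1 := (mul_one _).symm
      _ ≤ C₀ * (A ^ (r / d) * (m : ℝ) ^ (-(r / d))) := by gcongr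
      _ = C₀ * A ^ (r / d) * (m : ℝ) ^ (-(r / d)) := by ring
      _ ≤ _ := by gcongr; exact le_add_of_nonneg_right (by positivity)
  · obtain ⟨N, hN1, hN2⟩ := exists_nat_pow_near (x := (m : ℝ) / A) (y := 2 ^ d)
      (by rwa [one_le_div hA0]) (one_lt_pow₀ (by norm_num) hd.ne')
    obtain ⟨Θ, c, hcard, herr⟩ := hsp f hf N
    have hcm : Θ.card ≤ m := by
      rw [le_div_iff₀ hA0] at hN1
      have : (Θ.card : ℝ) ≤ m := by linarith
      exact_mod_cast this
    refine (bestApprox_le hd hcm c).trans (herr.trans (ENNReal.ofReal_le_ofReal ?_))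
    have h1 : (2 : ℝ) ^ (-(N * r)) ≤ (A * 2 ^ d) ^ (r / d) * (m : ℝ) ^ (-(r / d)) := by
      rw [← key _ (by positivity)]
      have e : (2 : ℝ) ^ (-(N * r)) = (((2 ^ d) ^ N)⁻¹) ^ (r / d) := by
        rw [← pow_mul, ← Real.rpow_natCast, ← Real.rpow_neg (by norm_num),
          ← Real.rpow_mul (by norm_num)]
        congr 1; push_cast; field_simp
      rw [e]
      refine Real.rpow_le_rpow (by positivity) ?_ hrd.le
      rw [pow_succ, div_lt_iff₀ hA0] at hN2
      rw [← div_eq_mul_inv, le_div_iff₀ hm0, inv_mul_le_iff₀ (by positivity)]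
      nlinarith
    calc C₁ * 2 ^ (-(N * r)) ≤ C₁ * ((A * 2 ^ d) ^ (r / d) * (m : ℝ) ^ (-(r / d))) := by gcongr
      _ = C₁ * (A * 2 ^ d) ^ (r / d) * (m : ℝ) ^ (-(r / d)) := by ring
      _ ≤ _ := by gcongr; exact le_add_of_nonneg_left (by positivity)

/-! ### Rudin-Shapiro polynomials and the extremal function -/

/-- The recursion `(P, Q) ↦ (P + z^{2^S} Q, P - z^{2^S} Q)` doubles `|P|² + |Q|²` on the unit circle
by the parallelogram law. Off the circle each step costs a power of `max 1 |z|`, and the exponents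
add up to at most `2^{S+1}`. -/
lemma exists_rudinShapiro_pair (S : ℕ) : ∃ a b : ℕ → ℂ, (∀ ν, ‖a ν‖ = 1) ∧ (∀ ν, ‖b ν‖ = 1) ∧
    ∀ z : ℂ, ‖∑ ν ∈ Finset.range (2 ^ S), a ν * z ^ ν‖ ^ 2 +
      ‖∑ ν ∈ Finset.range (2 ^ S), b ν * z ^ ν‖ ^ 2 ≤ 2 ^ (S + 1) * max 1 ‖z‖ ^ 2 ^ (S + 1) := by
  induction S with
  | zero =>
    refine ⟨fun _ => 1, fun _ => 1, by simp, by simp, fun z => ?_⟩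
    have : (1 : ℝ) ≤ max 1 ‖z‖ ^ 2 ^ (0 + 1) := one_le_pow₀ (le_max_left _ _)
    norm_num at this ⊢
    linarith
  | succ S ih =>
    obtain ⟨a, b, ha, hb, h⟩ := ih
    have hsum : ∀ (b' : ℕ → ℂ) (z : ℂ), ∑ ν ∈ Finset.range (2 ^ (S + 1)),
        (if ν < 2 ^ S then a ν else b' (ν - 2 ^ S)) * z ^ ν =
        ∑ ν ∈ Finset.range (2 ^ S), a ν * z ^ ν +
          z ^ 2 ^ S * ∑ ν ∈ Finset.range (2 ^ S), b' ν * z ^ ν := by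
      intro b' z
      rw [pow_succ, mul_two, Finset.sum_range_add, Finset.mul_sum]
      congr 1
      · refine Finset.sum_congr rfl fun ν hν => ?_
        rw [if_pos (Finset.mem_range.1 hν)]
      · refine Finset.sum_congr rfl fun ν _ => ?_
        rw [if_neg (by omega), Nat.add_sub_cancel_left, pow_add]
        ring
    refine ⟨fun ν => if ν < 2 ^ S then a ν else b (ν - 2 ^ S),
      fun ν => if ν < 2 ^ S then a ν else -b (ν - 2 ^ S), fun ν => ?_, fun ν => ?_, fun z => ?_⟩
    · dsimp only; split_ifs <;> simp [ha, hb]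
    · dsimp only; split_ifs <;> simp [ha, hb]
    · rw [hsum b z, hsum (fun ν => -b ν) z]
      set A := ∑ ν ∈ Finset.range (2 ^ S), a ν * z ^ ν with hA
      set B := ∑ ν ∈ Finset.range (2 ^ S), b ν * z ^ ν with hB
      have e1 : ∑ ν ∈ Finset.range (2 ^ S), -b ν * z ^ ν = -B := by
        rw [hB, ← Finset.sum_neg_distrib]
        exact Finset.sum_congr rfl fun ν _ => by ring
      have e2 := parallelogram_law_with_norm ℝ A (z ^ 2 ^ S * B)
      rw [e1, mul_neg, ← sub_eq_add_neg]
      set ρ := max 1 ‖z‖ with hρ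
      have hρ1 : 1 ≤ ρ := le_max_left _ _
      have hw : ‖z ^ 2 ^ S * B‖ ^ 2 ≤ ρ ^ 2 ^ (S + 1) * ‖B‖ ^ 2 := by
        rw [norm_mul, mul_pow, norm_pow, ← pow_mul, ← pow_succ]
        gcongr
        exact le_max_right _ _
      have hAle : ‖A‖ ^ 2 ≤ ρ ^ 2 ^ (S + 1) * ‖A‖ ^ 2 :=
        le_mul_of_one_le_left (by positivity) (one_le_pow₀ hρ1)
      have h1 := h z
      calc ‖A + z ^ 2 ^ S * B‖ ^ 2 + ‖A - z ^ 2 ^ S * B‖ ^ 2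
          = 2 * (‖A‖ ^ 2 + ‖z ^ 2 ^ S * B‖ ^ 2) := by linear_combination e2
        _ ≤ 2 * (ρ ^ 2 ^ (S + 1) * (‖A‖ ^ 2 + ‖B‖ ^ 2)) := by linarith
        _ ≤ 2 * (ρ ^ 2 ^ (S + 1) * (2 ^ (S + 1) * ρ ^ 2 ^ (S + 1))) := by gcongr
        _ = _ := by ring

/-- Polynomials of degree below `2^S` with unimodular coefficients that are of size `2^(S/2)` not
only on the unit circle but also in an annulus of width `2^(-S)` around it. -/
lemma exists_rudinShapiro (S : ℕ) : ∃ a : ℕ → ℂ, (∀ ν, ‖a ν‖ = 1) ∧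
    ∀ z : ℂ, ‖z‖ ≤ Real.exp (2 ^ S)⁻¹ →
      ‖∑ ν ∈ Finset.range (2 ^ S), a ν * z ^ ν‖ ≤ Real.exp 1 * √2 * √(2 ^ S) := by
  obtain ⟨a, b, ha, -, h⟩ := exists_rudinShapiro_pair S
  refine ⟨a, ha, fun z hz => ?_⟩
  have h1 : max 1 ‖z‖ ^ 2 ^ (S + 1) ≤ Real.exp 1 ^ 2 := by
    have h2 : max 1 ‖z‖ ≤ Real.exp (2 ^ S)⁻¹ := max_le (Real.one_le_exp (by positivity)) hz
    calc max 1 ‖z‖ ^ 2 ^ (S + 1) ≤ Real.exp (2 ^ S)⁻¹ ^ 2 ^ (S + 1) := by gcongr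
      _ = Real.exp 1 ^ 2 := by
          rw [pow_succ, pow_mul, ← Real.exp_nat_mul]
          congr 2
          push_cast
          exact mul_inv_cancel₀ (by positivity)
  refine le_of_sq_le_sq ?_ (by positivity)
  calc ‖∑ ν ∈ Finset.range (2 ^ S), a ν * z ^ ν‖ ^ 2
      ≤ 2 ^ (S + 1) * max 1 ‖z‖ ^ 2 ^ (S + 1) :=
        le_trans (le_add_of_nonneg_right (by positivity)) (h z)
    _ ≤ 2 ^ (S + 1) * Real.exp 1 ^ 2 := by gcongr
    _ = _ := by
        rw [mul_pow, mul_pow, Real.sq_sqrt (by norm_num), Real.sq_sqrt (by positivity)]; ring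

/-- Cauchy's estimate for differences: a function bounded in a strip has small differences. -/
lemma norm_fwdDiff_iter_le {F : ℂ → ℂ} (hF : Differentiable ℂ F) {M R ε : ℝ} (hε : 0 < ε)
    (hM : ∀ z, |z.im| ≤ R → ‖F z‖ ≤ M) (k : ℕ) :
    Differentiable ℂ ((fwdDiff 1)^[k] F) ∧
      ∀ z : ℂ, |z.im| ≤ R - k * ε → ‖(fwdDiff 1)^[k] F z‖ ≤ M * (ε⁻¹) ^ k := by
  induction k with
  | zero => exact ⟨hF, fun z hz => by simpa using hM z (by simpa using hz)⟩
  | succ k ih =>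
    obtain ⟨hG, hb⟩ := ih
    rw [Function.iterate_succ_apply']
    set G := (fwdDiff 1)^[k] F with hGdef
    refine ⟨?_, fun z hz => ?_⟩
    · unfold fwdDiff
      exact (hG.comp (differentiable_id.add_const 1)).sub hG
    · have hder : ∀ w : ℂ, w.im = z.im → ‖deriv G w‖ ≤ M * ε⁻¹ ^ k / ε := by
        intro w hw
        refine Complex.norm_deriv_le_of_forall_mem_sphere_norm_le hε hG.diffContOnCl
          fun v hv => hb v ?_
        rw [mem_sphere_iff_norm] at hv
        have h1 : |(v - w).im| ≤ ε := hv ▸ Complex.abs_im_le_norm _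
        have h2 : v.im = (v - w).im + z.im := by rw [Complex.sub_im, hw]; ring
        rw [h2]
        push_cast at hz
        calc _ ≤ |(v - w).im| + |z.im| := abs_add_le _ _
          _ ≤ R - k * ε := by linarith
      -- The segment from `z` to `z + 1` is horizontal, so the mean value inequality needs the
      -- derivative only on this line.
      have hconv : Convex ℝ {w : ℂ | w.im = z.im} := by
        intro u hu v hv s t _ _ hst
        change u.im = z.im at hu
        change v.im = z.im at hv
        change (s • u + t • v).im = z.im
        simp only [Complex.add_im, Complex.real_smul, Complex.im_ofReal_mul, hu, hv]
        rw [← add_mul, hst, one_mul]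
      have := hconv.norm_image_sub_le_of_norm_deriv_le (f := G) (x := z) (y := z + 1)
        (fun w _ => hG w) (fun w hw => hder w hw) rfl (show (z + 1).im = z.im by simp)
      simp only [add_sub_cancel_left, norm_one, mul_one] at this
      change ‖G (z + 1) - G z‖ ≤ _
      refine this.trans (le_of_eq ?_)
      rw [pow_succ]; ring

lemma fourier_eq_pow (ν : ℕ) (x : AddCircle (2 * π)) :
    (fourier (ν : ℤ) x : ℂ) = (AddCircle.toCircle x : ℂ) ^ ν := by
  rw [fourier_apply, natCast_zsmul, AddCircle.toCircle_nsmul]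
  simp

lemma toCircle_add_nsmul_coe (x : AddCircle (2 * π)) (t : ℝ) (i : ℕ) :
    (AddCircle.toCircle (x + i • (t : AddCircle (2 * π))) : ℂ) =
      AddCircle.toCircle x * Complex.exp (Complex.I * t * i) := by
  rw [AddCircle.toCircle_add, AddCircle.toCircle_nsmul]
  push_cast
  congr 1
  rw [AddCircle.toCircle_apply_mk, Circle.coe_exp, ← Complex.exp_nat_mul]
  congr 1
  push_cast
  field_simp

lemma norm_fwdDiff_iter_le_two_pow {f : Torus d → ℂ} {M : ℝ} (hM : ∀ x, ‖f x‖ ≤ M) (h : Torus d)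
    (k : ℕ) (x : Torus d) : ‖(fwdDiff h)^[k] f x‖ ≤ M * 2 ^ k := by
  induction k generalizing x with
  | zero => simpa using hM x
  | succ k ih =>
    rw [Function.iterate_succ_apply']
    refine (norm_sub_le _ _).trans ((add_le_add (ih _) (ih x)).trans (le_of_eq ?_))
    rw [pow_succ]; ring

/-- The frequencies in the cube `[0, N)^d`. -/
def posBox (d N : ℕ) : Finset (Fin d → ℤ) := Fintype.piFinset fun _ => Finset.Ico 0 (N : ℤ)

lemma card_posBox (d N : ℕ) : (posBox d N).card = N ^ d := by simp [posBox]

lemma supAbs_le_of_mem_posBox {N : ℕ} {n : Fin d → ℤ} (h : n ∈ posBox d N) : supAbs n ≤ N := by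
  rw [supAbs_le_iff]
  intro j
  have := Finset.mem_Ico.1 (Fintype.mem_piFinset.1 h j)
  omega

lemma trigPoly_posBox (N : ℕ) (a : ℕ → ℂ) (x : Torus d) :
    trigPoly (posBox d N) (fun n => ∏ j, a (n j).toNat) x =
      ∏ j, ∑ ν ∈ Finset.range N, a ν * (AddCircle.toCircle (x j) : ℂ) ^ ν := by
  have h : ∀ j, ∑ ν ∈ Finset.range N, a ν * (AddCircle.toCircle (x j) : ℂ) ^ ν =
      ∑ ν ∈ Finset.Ico 0 (N : ℤ), a ν.toNat * fourier ν (x j) := by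
    intro j
    refine Finset.sum_bij' (fun ν _ => (ν : ℤ)) (fun ν _ => ν.toNat) ?_ ?_ ?_ ?_ ?_
    · intro ν hν; simpa using hν
    · intro ν hν
      rw [Finset.mem_Ico] at hν; rw [Finset.mem_range]; omega
    · intro ν _; simp
    · intro ν hν
      rw [Finset.mem_Ico] at hν; simp [hν.1]
    · intro ν _
      rw [fourier_eq_pow]; simp
  simp only [h]
  rw [Finset.prod_univ_sum]
  refine Finset.sum_congr rfl fun n _ => ?_
  rw [expo, Finset.prod_mul_distrib]

/-- A trigonometric polynomial with unimodular coefficients on the cube `[0, 2^S)^d` whose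
differences are as small as its `L_2` norm and Bernstein's inequality suggest. -/
lemma exists_flat_trigPoly (d S : ℕ) : ∃ b : (Fin d → ℤ) → ℂ, (∀ n, ‖b n‖ = 1) ∧
    (∀ x, ‖trigPoly (posBox d (2 ^ S)) b x‖ ≤ (Real.exp 1 * √2 * √(2 ^ S)) ^ d) ∧
    ∀ k : ℕ, 0 < k → ∀ t : ℝ, 0 < t → ∀ h : EuclideanSpace ℝ (Fin d), ‖h‖ ≤ t → ∀ x,
      ‖(fwdDiff (toTorus h))^[k] (trigPoly (posBox d (2 ^ S)) b) x‖ ≤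
        (Real.exp 1 * √2 * √(2 ^ S)) ^ d * (k * (2 ^ S * t)) ^ k := by
  obtain ⟨a, ha, hbd⟩ := exists_rudinShapiro S
  set M := Real.exp 1 * √2 * √(2 ^ S) with hM
  set b : (Fin d → ℤ) → ℂ := fun n => ∏ j, a (n j).toNat with hb
  refine ⟨b, fun n => ?_, fun x => ?_, ?_⟩
  · rw [hb]; simp [norm_prod, ha]
  · rw [trigPoly_posBox, norm_prod]
    refine (Finset.prod_le_prod (fun _ _ => norm_nonneg _) fun j _ => hbd _ ?_).trans
      (le_of_eq (by simp))
    rw [Circle.norm_coe]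
    exact Real.one_le_exp (by positivity)
  intro k hk t ht h hht x
  -- The translate of the polynomial by `z h`, continued to complex `z`; unit differences of `F` at
  -- `0` are differences with step `h` at `x`.
  set F : ℂ → ℂ := fun z => ∏ j, ∑ ν ∈ Finset.range (2 ^ S),
    a ν * ((AddCircle.toCircle (x j) : ℂ) * Complex.exp (Complex.I * (h j : ℝ) * z)) ^ ν with hF
  have hFd : Differentiable ℂ F := by
    rw [hF]
    fun_prop
  have hFx : ∀ i : ℕ, trigPoly (posBox d (2 ^ S)) b (x + i • toTorus h) = F (0 + i • 1) := by
    intro i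
    rw [hb, trigPoly_posBox, hF]
    refine Finset.prod_congr rfl fun j _ => Finset.sum_congr rfl fun ν _ => ?_
    have : (x + i • toTorus h) j = x j + i • ((h j : ℝ) : AddCircle (2 * π)) := rfl
    rw [this, toCircle_add_nsmul_coe]
    simp
  have heq : (fwdDiff (toTorus h))^[k] (trigPoly (posBox d (2 ^ S)) b) x =
      (fwdDiff 1)^[k] F 0 := by
    rw [fwdDiff_iter_eq_sum_shift, fwdDiff_iter_eq_sum_shift]
    exact Finset.sum_congr rfl fun i _ => by rw [hFx]
  -- As `|h_j| ≤ t`, this width of the strip keeps each factor in the region `|w| ≤ exp(2^{-S})`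
  -- where the Rudin–Shapiro bound holds.
  have hFM : ∀ z : ℂ, |z.im| ≤ (2 ^ S * t)⁻¹ → ‖F z‖ ≤ M ^ d := by
    intro z hz
    rw [hF]
    simp only
    rw [norm_prod]
    refine (Finset.prod_le_prod (fun _ _ => norm_nonneg _) fun j _ => hbd _ ?_).trans
      (le_of_eq (by simp))
    rw [norm_mul, Circle.norm_coe, one_mul, Complex.norm_exp]
    refine Real.exp_le_exp.2 ?_
    have e1 : (Complex.I * (h j : ℝ) * z).re = -(h j * z.im) := by
      simp [Complex.mul_re, Complex.mul_im]
    rw [e1]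
    have e2 : |h j| ≤ t := (PiLp.norm_apply_le h j).trans hht
    calc -(h j * z.im) ≤ |h j * z.im| := neg_le_abs _
      _ = |h j| * |z.im| := abs_mul _ _
      _ ≤ t * (2 ^ S * t)⁻¹ := by gcongr
      _ = (2 ^ S)⁻¹ := by field_simp
  have hk' : (0 : ℝ) < k := by exact_mod_cast hk
  rw [heq]
  -- With `ε` equal to the half-width divided by `k`, the `k` applications of Cauchy's estimate
  -- exactly exhaust the strip down to the real axis.
  refine ((norm_fwdDiff_iter_le hFd (ε := (k * (2 ^ S * t))⁻¹) (by positivity) hFM k).2 0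
    ?_).trans (le_of_eq ?_)
  · rw [mul_inv (k : ℝ), mul_inv_cancel_left₀ hk'.ne']
    simp
  · rw [inv_inv]

/-! ### The lower bound -/

lemma lintegral_Ioc_rpow {α a : ℝ} (hα : 0 < α) (ha : 0 < a) :
    ∫⁻ t in Ioc 0 a, ENNReal.ofReal ((a⁻¹ * t) ^ α * t⁻¹) = ENNReal.ofReal α⁻¹ := by
  have h1 : ∀ t ∈ Ioc 0 a, (a⁻¹ * t) ^ α * t⁻¹ = (a ^ α)⁻¹ * t ^ (α - 1) := by
    intro t ht
    rw [Real.mul_rpow (by positivity) ht.1.le, Real.inv_rpow ha.le, Real.rpow_sub_one ht.1.ne']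
    ring
  have hint : IntegrableOn (fun t : ℝ => (a ^ α)⁻¹ * t ^ (α - 1)) (Ioc 0 a) :=
    ((intervalIntegrable_iff_integrableOn_Ioc_of_le ha.le).1
      (intervalIntegral.intervalIntegrable_rpow' (by linarith))).const_mul _
  rw [setLIntegral_congr_fun measurableSet_Ioc fun t ht => by rw [h1 t ht],
    ← ofReal_integral_eq_lintegral_ofReal hint]
  · congr 1
    rw [integral_const_mul, ← intervalIntegral.integral_of_le ha.le,
      integral_rpow (Or.inl (by linarith)), sub_add_cancel, Real.zero_rpow hα.ne', sub_zero]
    have : a ^ α ≠ 0 := by positivity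
    field_simp
  · filter_upwards [ae_restrict_mem measurableSet_Ioc] with t ht
    have := ht.1
    simp only [Pi.zero_apply]
    positivity

lemma lintegral_Ioi_rpow_neg {α a : ℝ} (hα : 0 < α) (ha : 0 < a) :
    ∫⁻ t in Ioi a, ENNReal.ofReal ((a⁻¹ * t) ^ (-α) * t⁻¹) = ENNReal.ofReal α⁻¹ := by
  have h1 : ∀ t ∈ Ioi a, (a⁻¹ * t) ^ (-α) * t⁻¹ = a ^ α * t ^ (-α - 1) := by
    intro t ht
    have ht0 : 0 < t := ha.trans ht
    rw [Real.mul_rpow (by positivity) ht0.le, Real.inv_rpow ha.le, Real.rpow_neg ha.le, inv_inv,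
      Real.rpow_sub_one ht0.ne']
    ring
  have hint : IntegrableOn (fun t : ℝ => a ^ α * t ^ (-α - 1)) (Ioi a) :=
    (integrableOn_Ioi_rpow_of_lt (by linarith) ha).const_mul _
  rw [setLIntegral_congr_fun measurableSet_Ioi fun t ht => by rw [h1 t ht],
    ← ofReal_integral_eq_lintegral_ofReal hint]
  · congr 1
    rw [integral_const_mul, integral_Ioi_rpow_of_lt (by linarith) ha, sub_add_cancel,
      Real.rpow_neg ha.le]
    have : a ^ α ≠ 0 := by positivity
    field_simp
  · filter_upwards [ae_restrict_mem measurableSet_Ioi] with t ht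
    have : 0 < t := ha.trans ht
    simp only [Pi.zero_apply]
    positivity

/-- A modulus of smoothness dominated by that of a function of frequency `1 / a` has a Besov
seminorm dominated by the corresponding amplitude. -/
lemma besovSeminorm_le {k : ℕ} {r : ℝ} (hr : 0 < r) (hk : r < k) {p θ : ℝ≥0∞} (hθ : 1 ≤ θ)
    {f : Torus d → ℂ} {a A : ℝ} (ha : 0 < a) (hA : 0 ≤ A)
    (hmod : ∀ t, 0 < t → modulus k p f t ≤ ENNReal.ofReal (A * a ^ r * min ((a⁻¹ * t) ^ k) 1)) :
    besovSeminorm k r p θ f ≤ ENNReal.ofReal (A * (1 + 2 * (min r (k - r))⁻¹)) := by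
  -- The profile `u^{-r} min(u^k, 1)` is at most `u^α` for `u ≤ 1` and `u^{-α}` for `u ≥ 1`; this is
  -- where `0 < r < k` enters.
  set α := min r (k - r) with hαdef
  have hα : 0 < α := lt_min hr (by linarith)
  have hbd : ∀ t, 0 < t → ENNReal.ofReal (t ^ (-r)) * modulus k p f t ≤
      ENNReal.ofReal (A * ((a⁻¹ * t) ^ (-r) * min ((a⁻¹ * t) ^ k) 1)) := by
    intro t ht
    refine (mul_le_mul' le_rfl (hmod t ht)).trans (le_of_eq ?_)
    rw [← ENNReal.ofReal_mul (by positivity), Real.mul_rpow (by positivity) ht.le,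
      Real.inv_rpow ha.le, Real.rpow_neg ha.le, inv_inv]
    congr 1; ring
  have hlow : ∀ u : ℝ, 0 < u → u ≤ 1 → u ^ (-r) * min (u ^ k) 1 ≤ u ^ α := by
    intro u hu hu1
    calc u ^ (-r) * min (u ^ k) 1 ≤ u ^ (-r) * u ^ k := by gcongr; exact min_le_left _ _
      _ = u ^ (k - r) := by
          rw [← Real.rpow_natCast, ← Real.rpow_add hu]; congr 1; ring
      _ ≤ u ^ α := Real.rpow_le_rpow_of_exponent_ge hu hu1 (min_le_right _ _)
  have hhigh : ∀ u : ℝ, 1 ≤ u → u ^ (-r) * min (u ^ k) 1 ≤ u ^ (-α) := by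
    intro u hu1
    have hu : 0 < u := by linarith
    calc u ^ (-r) * min (u ^ k) 1 ≤ u ^ (-r) * 1 := by gcongr; exact min_le_right _ _
      _ = u ^ (-r) := mul_one _
      _ ≤ u ^ (-α) := Real.rpow_le_rpow_of_exponent_le hu1 (neg_le_neg (min_le_left _ _))
  have hone : ∀ u : ℝ, 0 < u → u ^ (-r) * min (u ^ k) 1 ≤ 1 := by
    intro u hu
    rcases le_total u 1 with h | h
    · exact (hlow u hu h).trans (Real.rpow_le_one hu.le h hα.le)
    · exact (hhigh u h).trans (Real.rpow_le_one_of_one_le_of_nonpos h (by linarith))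
  have hα' : 0 < α⁻¹ := inv_pos.2 hα
  unfold besovSeminorm
  split_ifs with hinf
  · refine iSup₂_le fun t ht => (hbd t ht).trans (ENNReal.ofReal_le_ofReal ?_)
    refine mul_le_mul_of_nonneg_left ((hone _ (by positivity)).trans ?_) hA
    linarith
  · have hθ1 : 1 ≤ θ.toReal := by
      rw [← ENNReal.toReal_one]
      exact ENNReal.toReal_mono hinf hθ
    have hθ0 : 0 < θ.toReal := by linarith
    have hpt : ∀ t, 0 < t → (ENNReal.ofReal (t ^ (-r)) * modulus k p f t) ^ θ.toReal *
        ENNReal.ofReal t⁻¹ ≤ ENNReal.ofReal A ^ θ.toReal *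
          ENNReal.ofReal ((a⁻¹ * t) ^ (-r) * min ((a⁻¹ * t) ^ k) 1 * t⁻¹) := by
      intro t ht
      have h0 : 0 ≤ (a⁻¹ * t) ^ (-r) * min ((a⁻¹ * t) ^ k) 1 := by positivity
      rw [ENNReal.ofReal_mul h0, ← mul_assoc]
      refine mul_le_mul' ?_ le_rfl
      refine (ENNReal.rpow_le_rpow (hbd t ht) hθ0.le).trans ?_
      rw [ENNReal.ofReal_mul hA, ENNReal.mul_rpow_of_nonneg _ _ hθ0.le]
      refine mul_le_mul' le_rfl ?_
      rw [ENNReal.ofReal_rpow_of_nonneg h0 hθ0.le]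
      refine ENNReal.ofReal_le_ofReal ?_
      -- The profile is at most `1` and `θ ≥ 1`, so the case of exponent `1`, with integral at most
      -- `2/α`, serves every finite `θ`.
      exact Real.rpow_le_self_of_le_one h0 (hone _ (by positivity)) hθ1
    have hint : ∫⁻ t in Ioi (0 : ℝ),
        ENNReal.ofReal ((a⁻¹ * t) ^ (-r) * min ((a⁻¹ * t) ^ k) 1 * t⁻¹) ≤
        ENNReal.ofReal (1 + 2 * α⁻¹) := by
      rw [← Ioc_union_Ioi_eq_Ioi ha.le]
      calc _ ≤ _ := lintegral_union_le _ _ _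
        _ ≤ (∫⁻ t in Ioc 0 a, ENNReal.ofReal ((a⁻¹ * t) ^ α * t⁻¹)) +
            ∫⁻ t in Ioi a, ENNReal.ofReal ((a⁻¹ * t) ^ (-α) * t⁻¹) := by
            refine add_le_add (setLIntegral_mono' measurableSet_Ioc fun t ht => ?_)
              (setLIntegral_mono' measurableSet_Ioi fun t ht => ?_)
            · have ht0 : 0 < t := ht.1
              refine ENNReal.ofReal_le_ofReal (mul_le_mul_of_nonneg_right ?_ (by positivity))
              refine hlow _ (by positivity) ?_
              rw [inv_mul_le_iff₀ ha, mul_one]; exact ht.2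
            · have ht0 : 0 < t := ha.trans ht
              refine ENNReal.ofReal_le_ofReal (mul_le_mul_of_nonneg_right ?_ (by positivity))
              refine hhigh _ ?_
              rw [← div_eq_inv_mul, one_le_div ha]; exact (mem_Ioi.1 ht).le
        _ = ENNReal.ofReal (2 * α⁻¹) := by
            rw [lintegral_Ioc_rpow hα ha, lintegral_Ioi_rpow_neg hα ha,
              ← ENNReal.ofReal_add hα'.le hα'.le, two_mul]
        _ ≤ _ := ENNReal.ofReal_le_ofReal (by linarith)
    rw [one_div, ENNReal.rpow_inv_le_iff hθ0]
    calc _ ≤ ∫⁻ t in Ioi (0 : ℝ), ENNReal.ofReal A ^ θ.toReal *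
          ENNReal.ofReal ((a⁻¹ * t) ^ (-r) * min ((a⁻¹ * t) ^ k) 1 * t⁻¹) :=
          setLIntegral_mono' measurableSet_Ioi fun t ht => hpt t ht
      _ = ENNReal.ofReal A ^ θ.toReal * ∫⁻ t in Ioi (0 : ℝ),
          ENNReal.ofReal ((a⁻¹ * t) ^ (-r) * min ((a⁻¹ * t) ^ k) 1 * t⁻¹) :=
          lintegral_const_mul' _ _ (ENNReal.rpow_ne_top_of_nonneg hθ0.le ENNReal.ofReal_ne_top)
      _ ≤ ENNReal.ofReal A ^ θ.toReal * ENNReal.ofReal (1 + 2 * α⁻¹) ^ θ.toReal := by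
          refine mul_le_mul' le_rfl (hint.trans ?_)
          have h1 : (1 : ℝ≥0∞) ≤ ENNReal.ofReal (1 + 2 * α⁻¹) := by
            rw [← ENNReal.ofReal_one]
            exact ENNReal.ofReal_le_ofReal (by linarith)
          calc _ = ENNReal.ofReal (1 + 2 * α⁻¹) ^ (1 : ℝ) := (ENNReal.rpow_one _).symm
            _ ≤ _ := ENNReal.rpow_le_rpow_of_exponent_le h1 hθ1
      _ = _ := by
          rw [ENNReal.ofReal_mul hA, ENNReal.mul_rpow_of_nonneg _ _ hθ0.le]

/-- All estimates are made in the sup norm and therefore hold for every `p`. The factor `2^{-Sd/2}`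
normalises the flat polynomial and `2^{-Sr}` compensates for its smoothness at frequency `2^S`. -/
lemma exists_flat_mem_besovClass (d k : ℕ) {r : ℝ} (hr : 0 < r) (hk : r < k) {p θ : ℝ≥0∞}
    (hθ : 1 ≤ θ) : ∃ η : ℝ, 0 < η ∧ ∀ S : ℕ, ∃ b : (Fin d → ℤ) → ℂ, (∀ n, ‖b n‖ = 1) ∧
      trigPoly (posBox d (2 ^ S)) (fun n => (η * (2 ^ (-(S * r)) * (√(2 ^ S) ^ d)⁻¹) : ℝ) * b n) ∈
        besovClass d k r p θ := by
  have hk0 : 0 < k := by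
    have : (0 : ℝ) < k := hr.trans hk
    exact_mod_cast this
  have hk1 : (1 : ℝ) ≤ k := by exact_mod_cast hk0
  -- The factor `(2k)^k` dominates both `k^k` from Cauchy's estimate and `2^k` from the triangle
  -- inequality.
  set D : ℝ := (Real.exp 1 * √2) ^ d * (2 * k) ^ k with hD
  have hD0 : 0 < D := by positivity
  set α := min r (k - r) with hαdef
  have hα : 0 < α := lt_min hr (by linarith)
  have hα' : 0 < α⁻¹ := inv_pos.2 hα
  -- The norm contributes `1` and the seminorm `1 + 2/α`, each times `η D`.
  set η : ℝ := (D * (2 + 2 * α⁻¹))⁻¹ with hη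
  have hη0 : 0 < η := by positivity
  refine ⟨η, hη0, fun S => ?_⟩
  obtain ⟨b, hb, hbd, hdiff⟩ := exists_flat_trigPoly d S
  refine ⟨b, hb, ?_⟩
  set f₀ := trigPoly (posBox d (2 ^ S)) b with hf₀
  set a : ℝ := (2 ^ S)⁻¹ with ha
  have ha0 : 0 < a := by positivity
  have har : a ^ r = 2 ^ (-(S * r)) := by
    rw [ha, ← Real.rpow_natCast, ← Real.rpow_neg (by norm_num), ← Real.rpow_mul (by norm_num),
      neg_mul]
  set c : ℝ := η * (2 ^ (-(S * r)) * (√(2 ^ S) ^ d)⁻¹) with hc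
  have hc0 : 0 < c := by positivity
  have hcM : c * (Real.exp 1 * √2 * √(2 ^ S)) ^ d * (2 * k) ^ k = η * D * a ^ r := by
    rw [hc, har, hD, mul_pow (Real.exp 1 * √2)]
    have : √(2 ^ S) ^ d ≠ 0 := by positivity
    field_simp
  have hf : trigPoly (posBox d (2 ^ S)) (fun n => (c : ℂ) * b n) = (c : ℂ) • f₀ := by
    ext x
    simp only [hf₀, trigPoly, Pi.smul_apply, smul_eq_mul, Finset.mul_sum, mul_assoc]
  rw [hf]
  have hnc : ‖(c : ℂ)‖ = c := by rw [Complex.norm_real, Real.norm_of_nonneg hc0.le]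
  have hiter : ∀ (h : Torus d) (x : Torus d), ‖(fwdDiff h)^[k] ((c : ℂ) • f₀) x‖ =
      c * ‖(fwdDiff h)^[k] f₀ x‖ := by
    intro h x
    rw [fwdDiff_iter_const_smul, Pi.smul_apply, norm_smul, hnc]
  have hmod : ∀ t, 0 < t → modulus k p ((c : ℂ) • f₀) t ≤
      ENNReal.ofReal ((η * D) * a ^ r * min ((a⁻¹ * t) ^ k) 1) := by
    intro t ht
    refine iSup₂_le fun h hht => eLpNorm_le_of_norm_le (fun x => ?_) p
    rw [hiter, mul_min_of_nonneg _ _ (by positivity), ← hcM]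
    refine le_min ?_ ?_
    · calc c * ‖(fwdDiff (toTorus h))^[k] f₀ x‖
          ≤ c * ((Real.exp 1 * √2 * √(2 ^ S)) ^ d * (k * (2 ^ S * t)) ^ k) := by
            gcongr; exact hdiff k hk0 t ht h hht x
        _ ≤ c * ((Real.exp 1 * √2 * √(2 ^ S)) ^ d * (2 * k * (2 ^ S * t)) ^ k) := by
            gcongr; linarith
        _ = _ := by rw [ha, inv_inv, mul_pow (2 * (k : ℝ))]; ring
    · calc c * ‖(fwdDiff (toTorus h))^[k] f₀ x‖
          ≤ c * ((Real.exp 1 * √2 * √(2 ^ S)) ^ d * 2 ^ k) := by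
            gcongr; exact norm_fwdDiff_iter_le_two_pow hbd _ _ _
        _ ≤ c * ((Real.exp 1 * √2 * √(2 ^ S)) ^ d * (2 * k) ^ k) := by
            gcongr; linarith
        _ = _ := by ring
  have hcont : Continuous ((c : ℂ) • f₀) := (continuous_trigPoly _ _).const_smul (c : ℂ)
  refine ⟨(BoundedContinuousFunction.mkOfCompact ⟨_, hcont⟩).memLp_top.mono_exponent le_top, ?_⟩
  have h1 : eLpNorm ((c : ℂ) • f₀) p (μ d) ≤ ENNReal.ofReal (η * D) := by
    refine eLpNorm_le_of_norm_le (fun x => ?_) p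
    rw [Pi.smul_apply, norm_smul, hnc]
    have ha1 : a ^ r ≤ 1 := by
      refine Real.rpow_le_one ha0.le ?_ hr.le
      exact inv_le_one_of_one_le₀ (one_le_pow₀ (by norm_num))
    calc c * ‖f₀ x‖ ≤ c * (Real.exp 1 * √2 * √(2 ^ S)) ^ d * 1 := by
          rw [mul_one]; gcongr; exact hbd x
      _ ≤ c * (Real.exp 1 * √2 * √(2 ^ S)) ^ d * (2 * k) ^ k := by
          gcongr; exact one_le_pow₀ (by linarith)
      _ = η * D * a ^ r := hcM
      _ ≤ η * D * 1 := by gcongr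
      _ = _ := mul_one _
  have h2 := besovSeminorm_le hr hk hθ ha0 (by positivity : 0 ≤ η * D) hmod
  calc besovNorm k r p θ ((c : ℂ) • f₀)
      ≤ ENNReal.ofReal (η * D) + ENNReal.ofReal (η * D * (1 + 2 * α⁻¹)) := add_le_add h1 h2
    _ = ENNReal.ofReal 1 := by
        rw [← ENNReal.ofReal_add (by positivity) (by positivity)]
        congr 1
        rw [hη]
        have : D * (2 + 2 * α⁻¹) ≠ 0 := by positivity
        calc _ = (D * (2 + 2 * α⁻¹))⁻¹ * (D * (2 + 2 * α⁻¹)) := by ring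
          _ = 1 := inv_mul_cancel₀ this
    _ = 1 := ENNReal.ofReal_one

/-- `V_{2^S}` is the telescoping sum of `σ_0, …, σ_S`. -/
lemma eLpNorm_vpMean_le_bq1Norm {q : ℝ≥0∞} (hq : 1 ≤ q) (S : ℕ) {g : Torus d → ℂ}
    (hg : Integrable g (μ d)) : eLpNorm (vpMean (2 ^ S) g) q (μ d) ≤ bq1Norm q g := by
  rw [← sum_sigma]
  exact (eLpNorm_sum_le (fun s _ => (continuous_sigma s hg).aestronglyMeasurable) hq).trans
    (ENNReal.sum_le_tsum _)

lemma fc_vpMean {S : ℕ} {g : Torus d → ℂ} (hg : Integrable g (μ d)) {n : Fin d → ℤ}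
    (hn : supAbs n ≤ 2 ^ S) : fc (vpMean (2 ^ S) g) n = fc g n := by
  rw [vpMean_eq_trigPoly_box _ hg, fc_trigPoly, if_pos (mem_box.2 (by omega)),
    vpm_eq_one (by positivity) hn, Complex.ofReal_one, one_mul]

/-- A polynomial with coefficients of modulus `c` on the cube `[0, 2^S)^d` is not approximated by
sums of half as many exponentials. -/
lemma le_bestApprox_flat {q : ℝ≥0∞} (hq : 2 ≤ q) {S m : ℕ} (hm : 2 * m ≤ (2 ^ S) ^ d)
    {b : (Fin d → ℤ) → ℂ} {c : ℝ} (hc : 0 ≤ c) (hb : ∀ n, ‖b n‖ = 1) :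
    ENNReal.ofReal (c * √(2 ^ S) ^ d / 2) ≤ bestApprox (bq1Norm q) m
      (trigPoly (posBox d (2 ^ S)) fun n => (c : ℂ) * b n) := by
  classical
  refine le_iInf₂ fun Θ hΘ => le_iInf fun e => ?_
  set f := trigPoly (posBox d (2 ^ S)) fun n => (c : ℂ) * b n with hf
  have hfc : Continuous f := continuous_trigPoly _ _
  have hPc : Continuous (trigPoly Θ e) := continuous_trigPoly _ _
  set g := f - trigPoly Θ e with hg
  have hgi : Integrable g (μ d) := integrable_of_continuous (hfc.sub hPc)
  have hVc : Continuous (vpMean (2 ^ S) g) := by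
    rw [vpMean_eq_trigPoly_box _ hgi]; fun_prop
  have hV2 : MemLp (vpMean (2 ^ S) g) 2 (μ d) :=
    (BoundedContinuousFunction.mkOfCompact ⟨_, hVc⟩).memLp_top.mono_exponent le_top
  have hle : eLpNorm (vpMean (2 ^ S) g) 2 (μ d) ≤ bq1Norm q g :=
    (eLpNorm_le_eLpNorm_of_exponent_le hq hVc.aestronglyMeasurable).trans
      (eLpNorm_vpMean_le_bq1Norm (le_trans (by norm_num) hq) S hgi)
  refine le_trans ?_ hle
  rw [ENNReal.ofReal_le_iff_le_toReal hV2.2.ne]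
  refine le_of_sq_le_sq ?_ ENNReal.toReal_nonneg
  -- Frequencies of the cube outside `Θ` keep the coefficient of the flat polynomial, of modulus
  -- `c`, and they make up at least half of the cube.
  refine le_trans ?_ (sum_sq_fc_le hV2 (posBox d (2 ^ S) \ Θ))
  have hterm : ∀ n ∈ posBox d (2 ^ S) \ Θ, ‖fc (vpMean (2 ^ S) g) n‖ ^ 2 = c ^ 2 := by
    intro n hn
    rw [Finset.mem_sdiff] at hn
    rw [fc_vpMean hgi (supAbs_le_of_mem_posBox hn.1), hg,
      fc_sub (integrable_of_continuous hfc) (integrable_of_continuous hPc), hf, fc_trigPoly,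
      fc_trigPoly, if_pos hn.1, if_neg hn.2, sub_zero, norm_mul, hb, mul_one, Complex.norm_real,
      Real.norm_of_nonneg hc]
  rw [Finset.sum_congr rfl hterm, Finset.sum_const, nsmul_eq_mul]
  have hcard : (2 ^ S) ^ d ≤ 2 * (posBox d (2 ^ S) \ Θ).card := by
    have h1 := Finset.le_card_sdiff Θ (posBox d (2 ^ S))
    rw [card_posBox, hΘ] at h1
    omega
  have hcard' : ((2 : ℝ) ^ S) ^ d ≤ 2 * (posBox d (2 ^ S) \ Θ).card := by exact_mod_cast hcard
  have hsq : (√(2 ^ S) ^ d) ^ 2 = ((2 : ℝ) ^ S) ^ d := by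
    rw [← pow_mul, mul_comm d 2, pow_mul, Real.sq_sqrt (by positivity)]
  rw [div_pow, mul_pow, hsq]
  have hc2 : 0 ≤ c ^ 2 := by positivity
  nlinarith

lemma exists_le_bestApproxClass (k : ℕ) (hd : 0 < d) {r : ℝ} (hr : 0 < r) (hk : r < k)
    {p θ q : ℝ≥0∞} (hq : 2 ≤ q) (hθ : 1 ≤ θ) :
    ∃ C : ℝ, 0 < C ∧ ∀ m : ℕ, 1 ≤ m → ENNReal.ofReal (C * (m : ℝ) ^ (-(r / d))) ≤
      bestApproxClass (bq1Norm q) m (besovClass d k r p θ) := by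
  obtain ⟨η, hη, hex⟩ := exists_flat_mem_besovClass d k hr hk (p := p) hθ
  have hd' : (0 : ℝ) < d := by exact_mod_cast hd
  refine ⟨η / 2 * (2 * 2 ^ d) ^ (-(r / d)), by positivity, fun m hm => ?_⟩
  have hm1 : (1 : ℝ) ≤ m := by exact_mod_cast hm
  -- With `S = N + 1` this reads `2m < 2^{dS} ≤ 2 · 2^d m`: the cube is large enough for `m` terms,
  -- and `2^{-Sr}` is still of order `m^{-r/d}`.
  obtain ⟨N, hN1, hN2⟩ := exists_nat_pow_near (x := 2 * (m : ℝ)) (y := 2 ^ d) (by linarith)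
    (one_lt_pow₀ (by norm_num) hd.ne')
  set S := N + 1 with hS
  obtain ⟨b, hb, hf⟩ := hex S
  have hmS : 2 * m ≤ (2 ^ S) ^ d := by
    rw [← pow_mul, mul_comm S, pow_mul]
    have := hN2.le
    exact_mod_cast this
  have h0 : 0 < √((2 : ℝ) ^ S) ^ d := by positivity
  refine le_trans ?_ ((le_bestApprox_flat hq hmS (by positivity) hb).trans
    (le_iSup₂ (f := fun f (_ : f ∈ besovClass d k r p θ) => bestApprox (bq1Norm q) m f) _ hf))
  refine ENNReal.ofReal_le_ofReal ?_
  have e1 : η * (2 ^ (-(S * r)) * (√((2 : ℝ) ^ S) ^ d)⁻¹) * √((2 : ℝ) ^ S) ^ d / 2 =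
      η / 2 * 2 ^ (-(S * r)) := by
    field_simp
  have e2 : (2 : ℝ) ^ (-(S * r)) = ((2 ^ d) ^ S) ^ (-(r / d)) := by
    rw [← pow_mul, ← Real.rpow_natCast, ← Real.rpow_mul (by norm_num)]
    congr 1; push_cast; field_simp
  rw [e1, e2, mul_assoc, ← Real.mul_rpow (by positivity) (by positivity)]
  refine mul_le_mul_of_nonneg_left ?_ (by positivity)
  refine Real.rpow_le_rpow_of_nonpos (by positivity) ?_ (by rw [neg_nonpos]; positivity)
  rw [hS, pow_succ]
  nlinarith [show (0 : ℝ) < 2 ^ d by positivity]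

end NikolskiiBesov

end

/-! ### The embedding and the two-sided estimate -/

theorem theorem2 (d : ℕ) (hd : 1 ≤ d) (p q θ : ℝ≥0∞) (hp : 2 < p) (hpq : p < q) (hq : q < ∞)
    (hθ : 1 ≤ θ) (r : ℝ) (hr : (d : ℝ) / 2 < r) (k : ℕ) (hk : r < k) :
    NikolskiiBesov.besovClass d k r p θ ⊆ NikolskiiBesov.bq1Space d q ∧
    ∃ C₁ C₂ : ℝ, 0 < C₁ ∧ C₁ < C₂ ∧ ∀ m : ℕ, 1 ≤ m →
      ENNReal.ofReal (C₁ * (m : ℝ) ^ (-(r / (d : ℝ)))) ≤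
          NikolskiiBesov.bestApproxClass (NikolskiiBesov.bq1Norm q) m
            (NikolskiiBesov.besovClass d k r p θ) ∧
        NikolskiiBesov.bestApproxClass (NikolskiiBesov.bq1Norm q) m
            (NikolskiiBesov.besovClass d k r p θ) ≤
          ENNReal.ofReal (C₂ * (m : ℝ) ^ (-(r / (d : ℝ)))) := by
  have hr0 : 0 < r := lt_of_le_of_lt (by positivity) hr
  have hq2 : 2 ≤ q := hp.le.trans hpq.le
  have hq1 : 1 ≤ q := le_trans (by norm_num) hq2
  obtain ⟨C, -, hbd⟩ := NikolskiiBesov.exists_bq1Norm_le d k hr hp.le hq1 hθ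
  obtain ⟨C₁, hC₁, h₁⟩ := NikolskiiBesov.exists_le_bestApproxClass (p := p) k hd hr0 hk hq2 hθ
  obtain ⟨C₂, hC₂, h₂⟩ :=
    NikolskiiBesov.exists_bestApproxClass_le k hd hr hp.le hq1 hq.ne hθ
  -- The upper constant is enlarged to `C₁ + C₂` to make `C₁ < C₂` strict.
  refine ⟨fun f hf => ⟨(hbd f hf).1, (hbd f hf).2.trans_lt ENNReal.ofReal_lt_top⟩,
    C₁, C₁ + C₂, hC₁, by linarith, fun m hm => ⟨h₁ m hm, (h₂ m hm).trans ?_⟩⟩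
  gcongr
  linarith
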